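/- Let $f:\mathbb{R}^d\to\mathbb{R}$ be differentiable, $\tau$-strongly convex (that is, $f(y)\ge f(x)+\langle\nabla f(x),y-x\rangle+\frac{\tau}{2}\|x-y\|^2$ for all $x,y$) and $L$-smooth (that is, $\|\nabla f(x)-\nabla f(y)\|\le L\|x-y\|$ for all $x,y$), where $\tau,L>0$, and let $f$ be twice differentiable with $\|\nabla^2 f(y)-\nabla^2 f(x)\|\le\gamma\|y-x\|$ for all $x,y$, where $\gamma\ge 0$ and the norm of matrices is the spectral norm. Let $x^\star$ be the minimizer of $f$. Let $0<\rho\le 1$, $\zeta>0$, $\mu>0$, let $b$ be an integer with $1\le b\le d+2$, and put $\eta=\frac{b}{16(d+2)}$. The algorithm ZO-HessAware starts at a point $x_0$ and computes, for $t=0,1,2,\dots$, $$\tilde g_\mu(x_t)=\frac1b\sum_{i=1}^b\frac{f(x_t+\mu\tilde H_t^{-1/2}u_i)-f(x_t)}{\mu}\,\tilde H_t^{-1/2}u_i,\qquad x_{t+1}=x_t-\eta\,\tilde g_\mu(x_t),$$ where $u_1,\dots,u_b$ are independent $N(0,I_d)$ vectors, drawn afresh at every iteration. The matrix $\tilde H_t$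 is an approximate Hessian determined before these vectors are drawn; it is recomputed, by an arbitrary routine that may use everything sampled so far, when $t$ is a multiple of a fixed integer $p$, and otherwise $\tilde H_t=\tilde H_{t-1}$. Let $t\ge 0$ and fix the outcome of the first $t$ iterations. Suppose that the matrix $\tilde H_t$ satisfies $$\rho\tilde H_t\preceq\nabla^2 f(x_t)\preceq(2-\rho)\tilde H_t\qquad\text{and}\qquad \zeta I_d\preceq\tilde H_t,$$ and that $$\|x_t-x^\star\|\le\frac{\rho}{\gamma}\cdot\min\left(\frac{3\tau\zeta^{1/2}}{64L^{1/2}},\ \frac{d^{3/2}\zeta^2}{33L(d+2)b^2}\right)$$ (no condition on $x_t$ if $\gamma=0$). Then $f(x_{t+1})-f(x^\star)$ is integrable with respect to the draw of $u_1,\dots,u_b$ at iteration $t$, and its expectation over this draw satisfies $$\mathbb{E}\left[f(x_{t+1})-f(x^\star)\right]\le\left(1-\frac{b\rho}{64(d+2)}\right)\left(f(x_t)-f(x^\star)\right)+\Delta_\mu,$$ where $$\Delta_\mu=b\left(\frac{\mu^2L^2}{64\zeta^2}(d+5)^2+\frac{\mu^2L^2}{128\zeta}(d+38)+\frac{\gamma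 b^2\mu^3L^3}{6144\,\zeta^{9/2}}(d+110)^{3/2}\right).$$ -/

import Mathlib

open MeasureTheory ProbabilityTheory
open scoped InnerProductSpace MatrixOrder Gradient

noncomputable section

namespace ZOHessAware

/-- `f` is differentiable with `L`-Lipschitz gradient on `ℝᵈ`. -/
def LSmooth {d : ℕ} (L : ℝ) (f : EuclideanSpace ℝ (Fin d) → ℝ) : Prop :=
  Differentiable ℝ f ∧ ∀ x y, ‖∇ f x - ∇ f y‖ ≤ L * ‖x - y‖

/-- `f` is differentiable and `τ`-strongly convex on `ℝᵈ` (first-order form). -/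
def StronglyConvex {d : ℕ} (τ : ℝ) (f : EuclideanSpace ℝ (Fin d) → ℝ) : Prop :=
  Differentiable ℝ f ∧
    ∀ x y, f x + ⟪∇ f x, y - x⟫_ℝ + τ / 2 * ‖x - y‖ ^ 2 ≤ f y

/-- The Hessian of `f` at `x` as a linear operator: the derivative of the gradient. -/
def hessianOp {d : ℕ} (f : EuclideanSpace ℝ (Fin d) → ℝ) (x : EuclideanSpace ℝ (Fin d)) :
    EuclideanSpace ℝ (Fin d) →L[ℝ] EuclideanSpace ℝ (Fin d) :=
  fderiv ℝ (∇ f) x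

/-- The Hessian matrix of `f` at `x`. -/
def hessian {d : ℕ} (f : EuclideanSpace ℝ (Fin d) → ℝ) (x : EuclideanSpace ℝ (Fin d)) :
    Matrix (Fin d) (Fin d) ℝ :=
  (Matrix.toEuclideanCLM (n := Fin d) (𝕜 := ℝ)).symm (hessianOp f x)

/-- `f` is twice differentiable and its Hessian is `γ`-Lipschitz in the operator (spectral) norm. -/
def LipschitzHessian {d : ℕ} (γ : ℝ) (f : EuclideanSpace ℝ (Fin d) → ℝ) : Prop :=
  Differentiable ℝ f ∧ Differentiable ℝ (∇ f) ∧
    ∀ x y, ‖hessianOp f y - hessianOp f x‖ ≤ γ * ‖y - x‖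

/-- `ρ H ⪯ ∇²f(x) ⪯ (2 - ρ) H` and `ζ I ⪯ H` in the Loewner order. -/
def IsApproxHessian {d : ℕ} (f : EuclideanSpace ℝ (Fin d) → ℝ) (ρ ζ : ℝ)
    (x : EuclideanSpace ℝ (Fin d)) (H : Matrix (Fin d) (Fin d) ℝ) : Prop :=
  (hessian f x - ρ • H).PosSemidef ∧ ((2 - ρ) • H - hessian f x).PosSemidef ∧
    (H - ζ • (1 : Matrix (Fin d) (Fin d) ℝ)).PosSemidef

/-- The operator `H^{-1/2}` (the positive square root of `H⁻¹`) on `ℝᵈ`. -/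
def invSqrt {d : ℕ} (H : Matrix (Fin d) (Fin d) ℝ) :
    EuclideanSpace ℝ (Fin d) →L[ℝ] EuclideanSpace ℝ (Fin d) :=
  Matrix.toEuclideanCLM (n := Fin d) (𝕜 := ℝ) (CFC.sqrt H⁻¹)

/-- A batch of `b` sample directions in `ℝᵈ`. -/
abbrev Batch (d b : ℕ) : Type := Fin b → EuclideanSpace ℝ (Fin d)

/-- The law of a batch of `b` independent `N(0, I_d)` vectors. -/
def batchLaw (d b : ℕ) : Measure (Batch d b) :=
  Measure.pi fun _ => stdGaussian (EuclideanSpace ℝ (Fin d))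

/-- The search direction
`(1/b) ∑ᵢ (f(x + μ H^{-1/2} uᵢ) - f(x)) / μ • H^{-1/2} uᵢ`. -/
def direction {d b : ℕ} (f : EuclideanSpace ℝ (Fin d) → ℝ) (μ : ℝ)
    (H : Matrix (Fin d) (Fin d) ℝ) (x : EuclideanSpace ℝ (Fin d)) (u : Batch d b) :
    EuclideanSpace ℝ (Fin d) :=
  (1 / (b : ℝ)) • ∑ i, ((f (x + μ • invSqrt H (u i)) - f x) / μ) • invSqrt H (u i)

/-- The approximate Hessian `H_t` held by the algorithm at iteration `t`, given the batches
`U 0, …, U (t-1)` drawn before. It is recomputed when `p` divides `t` and kept otherwise.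
The routine `A` that computes it is arbitrary: its output may depend on the iteration and on
everything sampled before (any randomness internal to it is frozen into `A`). -/
def approxHess {d b : ℕ} (p : ℕ)
    (A : (t : ℕ) → (Fin t → Batch d b) → Matrix (Fin d) (Fin d) ℝ) :
    (t : ℕ) → (Fin t → Batch d b) → Matrix (Fin d) (Fin d) ℝ
  | 0, U => A 0 U
  | t + 1, U => if (t + 1) % p = 0 then A (t + 1) U else approxHess p A t (Fin.init U)

/-- The iterate `x_t` of the algorithm with start `x₀`, step size `η`, smoothing parameter `μ`,
batch size `b` and refresh period `p`, as a function of the batches `U 0, …, U (t-1)`: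
`x_{t+1} = x_t - η • direction f μ H_t x_t U_t`. -/
def iterate {d b : ℕ} (f : EuclideanSpace ℝ (Fin d) → ℝ) (μ η : ℝ) (p : ℕ)
    (A : (t : ℕ) → (Fin t → Batch d b) → Matrix (Fin d) (Fin d) ℝ)
    (x₀ : EuclideanSpace ℝ (Fin d)) :
    (t : ℕ) → (Fin t → Batch d b) → EuclideanSpace ℝ (Fin d)
  | 0, _ => x₀
  | t + 1, U =>
      iterate f μ η p A x₀ t (Fin.init U) -
        η • direction f μ (approxHess p A t (Fin.init U))
          (iterate f μ η p A x₀ t (Fin.init U)) (U (Fin.last t))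

/-- The smoothing error `Δ_μ`. -/
def smoothingError (d b : ℕ) (L γ ζ μ : ℝ) : ℝ :=
  b * (μ ^ 2 * L ^ 2 / (64 * ζ ^ 2) * ((d : ℝ) + 5) ^ 2
    + μ ^ 2 * L ^ 2 / (128 * ζ) * ((d : ℝ) + 38)
    + γ * (b : ℝ) ^ 2 * μ ^ 3 * L ^ 3 / (6144 * ζ ^ (9 / 2 : ℝ)) * ((d : ℝ) + 110) ^ (3 / 2 : ℝ))

end ZOHessAware

end

open ZOHessAware

/-!
Write `A = H^{-1/2}`, `g = ∇f(x)`, `h = A g` and `s = η / b = 1 / (16 (d + 2))`. The step is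
`x⁺ = x - s A w` with `w = ∑ᵢ c(uᵢ) uᵢ`, where the difference quotient `c(u)` differs from `⟪h, u⟫`
by at most `l ‖u‖²`, `l = L μ / (2 ζ)`. In the variable `w` the Hessian becomes `A ∇²f(x) A ≤ 2`,
so that (`apply_sub_smul_le`)

  `f(x⁺) ≤ f(x) - s ⟪h, w⟫ + s² ‖w‖² + (γ / 2) (s / √ζ)³ ‖w‖³`.

Only Gaussian moments are then needed. Up to terms in `l`, `E ⟪h, w⟫ ≥ (7 / 8) b ‖h‖²`
(`NearLinear.le_integral_mul_inner`). The second moment `E ‖w‖²` splits into a variance, with a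
factor `b (d + 2)`, and a squared mean, with a factor `b²` but no dimension
(`integral_norm_sum_sq_le`, `NearLinear.norm_integral_smul_sq_le`); as `b ≤ d + 2`, the step size
absorbs both. The third moment is of order `b³ (d + 2)^{3/2} ‖h‖³`, and it is negligible because
`γ ‖h‖ b²` is small near the minimizer (`mul_norm_mul_sq_le`). A fixed fraction of
`s b ‖h‖²` is left as decrease (`step_balance`), and a Polyak–Łojasiewicz inequality in the metric
of `H`, `ρ (f(x) - f(x⋆)) ≤ (67 / 64) ‖h‖²`, turns it into a contraction (`mul_gap_le_norm_sq`).
The terms in `l` make up the smoothing error.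

The bounds for `E ‖u‖^k` rest on the exact even moments `d (d + 2) ⋯ (d + 2k - 2)` up to order ten
(`integral_sum_sq_pow`): the `l³` term involves `E ‖u‖⁹`, where the leading constant in the
dimension matters.
-/

/-! ### Taylor estimates for functions with Lipschitz gradient or Hessian -/

/-- A derivative bounded by `C t` on `[0, 1]` gives an increment of at most `C / 2`. Taking the
bound linear in `t`, not constant, keeps the sharp factor `1 / 2` in the descent lemma. -/
lemma sub_le_half_of_hasDerivAt_le_mul {φ φ' : ℝ → ℝ} {C : ℝ}
    (hφ : ∀ t, HasDerivAt φ (φ' t) t) (hb : ∀ t, 0 ≤ t → t ≤ 1 → φ' t ≤ C * t) :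
    φ 1 - φ 0 ≤ C / 2 := by
  have h := image_le_of_deriv_right_le_deriv_boundary (f := φ) (f' := φ') (a := 0) (b := 1)
    (B := fun t => φ 0 + C / 2 * t ^ 2) (B' := fun t => C * t)
    (fun t _ => (hφ t).continuousAt.continuousWithinAt) (fun t _ => (hφ t).hasDerivWithinAt)
    (by simp) (by fun_prop)
    (fun t _ => by
      have := ((hasDerivAt_pow 2 t).const_mul (C / 2)).const_add (φ 0)
      refine (this.congr_deriv ?_).hasDerivWithinAt
      push_cast; ring)
    (fun t ht => hb t ht.1 ht.2.le) (Set.right_mem_Icc.2 zero_le_one)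
  simp only [one_pow, mul_one] at h
  linarith

section Taylor

variable {d : ℕ} {f : EuclideanSpace ℝ (Fin d) → ℝ}

lemma hasDerivAt_comp_add_smul (hf : Differentiable ℝ f) (x v : EuclideanSpace ℝ (Fin d))
    (t : ℝ) : HasDerivAt (fun t : ℝ => f (x + t • v)) ⟪∇ f (x + t • v), v⟫_ℝ t := by
  have h1 : HasDerivAt (fun t : ℝ => x + t • v) v t := by
    simpa using ((hasDerivAt_id t).smul_const v).const_add x
  have h2 := (hf (x + t • v)).hasFDerivAt.comp_hasDerivAt t h1
  rw [inner_gradient_left]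
  exact h2

/-- The descent lemma, in two-sided form. -/
lemma ZOHessAware.LSmooth.abs_sub_sub_inner_le {L : ℝ} (hf : LSmooth L f)
    (x v : EuclideanSpace ℝ (Fin d)) :
    |f (x + v) - f x - ⟪∇ f x, v⟫_ℝ| ≤ L / 2 * ‖v‖ ^ 2 := by
  have hd : ∀ t : ℝ, HasDerivAt (fun t : ℝ => f (x + t • v) - t * ⟪∇ f x, v⟫_ℝ)
      (⟪∇ f (x + t • v) - ∇ f x, v⟫_ℝ) t := fun t => by
    have h := (hasDerivAt_comp_add_smul hf.1 x v t).sub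
      ((hasDerivAt_id t).mul_const ⟪∇ f x, v⟫_ℝ)
    refine h.congr_deriv ?_
    rw [inner_sub_left, one_mul]
  have hb : ∀ t : ℝ, 0 ≤ t → |⟪∇ f (x + t • v) - ∇ f x, v⟫_ℝ| ≤ L * ‖v‖ ^ 2 * t := by
    intro t ht
    have h1 := hf.2 (x + t • v) x
    rw [add_sub_cancel_left, norm_smul, Real.norm_of_nonneg ht] at h1
    calc _ ≤ ‖∇ f (x + t • v) - ∇ f x‖ * ‖v‖ := abs_real_inner_le_norm _ _
      _ ≤ L * (t * ‖v‖) * ‖v‖ := by gcongr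
      _ = _ := by ring
  have h1 := sub_le_half_of_hasDerivAt_le_mul hd
    (fun t h0 _ => (le_abs_self _).trans (hb t h0))
  have h2 := sub_le_half_of_hasDerivAt_le_mul (fun t => (hd t).neg)
    (fun t h0 _ => (neg_le_abs _).trans (hb t h0))
  simp [-inner_gradient_left] at h1 h2
  rw [abs_le]
  constructor <;> linarith

lemma ZOHessAware.LipschitzHessian.norm_gradient_sub_sub_le {γ : ℝ} (hγ : 0 ≤ γ)
    (hf : LipschitzHessian γ f) (x v : EuclideanSpace ℝ (Fin d)) :
    ‖∇ f (x + v) - ∇ f x - hessianOp f x v‖ ≤ γ * ‖v‖ ^ 2 := by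
  have h := (convex_segment x (x + v)).norm_image_sub_le_of_norm_hasFDerivWithin_le'
    (f := ∇ f) (f' := hessianOp f) (φ := hessianOp f x) (C := γ * ‖v‖)
    (fun y _ => (hf.2.1 y).hasFDerivAt.hasFDerivWithinAt)
    (fun y hy => (hf.2.2 x y).trans (by
      gcongr
      simpa using norm_sub_le_of_mem_segment hy))
    (left_mem_segment ℝ x (x + v)) (right_mem_segment ℝ x (x + v))
  rw [add_sub_cancel_left] at h
  calc _ ≤ _ := h
    _ = _ := by ring

lemma ZOHessAware.LipschitzHessian.apply_add_le {γ : ℝ} (hγ : 0 ≤ γ)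
    (hf : LipschitzHessian γ f) (x v : EuclideanSpace ℝ (Fin d)) :
    f (x + v) ≤ f x + ⟪∇ f x, v⟫_ℝ + ⟪hessianOp f x v, v⟫_ℝ / 2 + γ / 2 * ‖v‖ ^ 3 := by
  have hd : ∀ t : ℝ, HasDerivAt
      (fun t : ℝ => f (x + t • v) - t * ⟪∇ f x, v⟫_ℝ - t ^ 2 / 2 * ⟪hessianOp f x v, v⟫_ℝ)
      (⟪∇ f (x + t • v) - ∇ f x - hessianOp f x (t • v), v⟫_ℝ) t := fun t => by
    have h := ((hasDerivAt_comp_add_smul hf.1 x v t).sub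
      ((hasDerivAt_id t).mul_const ⟪∇ f x, v⟫_ℝ)).sub
      (((hasDerivAt_pow 2 t).div_const 2).mul_const ⟪hessianOp f x v, v⟫_ℝ)
    refine h.congr_deriv ?_
    simp only [inner_sub_left, map_smul, inner_smul_left]
    simp
  have hb : ∀ t : ℝ, 0 ≤ t → t ≤ 1 →
      ⟪∇ f (x + t • v) - ∇ f x - hessianOp f x (t • v), v⟫_ℝ ≤ γ * ‖v‖ ^ 3 * t := by
    intro t ht ht1
    have h1 := hf.norm_gradient_sub_sub_le hγ x (t • v)
    rw [norm_smul, Real.norm_of_nonneg ht] at h1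
    calc _ ≤ ‖∇ f (x + t • v) - ∇ f x - hessianOp f x (t • v)‖ * ‖v‖ := real_inner_le_norm _ _
      _ ≤ γ * (t * ‖v‖) ^ 2 * ‖v‖ := by gcongr
      _ = γ * ‖v‖ ^ 3 * (t * t) := by ring
      _ ≤ γ * ‖v‖ ^ 3 * (t * 1) := by gcongr
      _ = _ := by ring
  have h1 := sub_le_half_of_hasDerivAt_le_mul hd hb
  simp [-inner_gradient_left] at h1
  linarith

lemma ZOHessAware.LSmooth.norm_hessianOp_le {L : ℝ} (hL : 0 ≤ L) (hf : LSmooth L f)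
    (x : EuclideanSpace ℝ (Fin d)) : ‖hessianOp f x‖ ≤ L :=
  norm_fderiv_le_of_lip' ℝ hL (Filter.Eventually.of_forall fun y => hf.2 y x)

lemma gradient_eq_zero_of_forall_le {xstar : EuclideanSpace ℝ (Fin d)}
    (h : ∀ y, f xstar ≤ f y) : ∇ f xstar = 0 := by
  have : IsLocalMin f xstar := Filter.Eventually.of_forall h
  simp [gradient, this.fderiv_eq_zero]

end Taylor

/-! ### The operator `H^{-1/2}` as a change of variables -/

/-- What the analysis of one step uses of the operator `A = H^{-1/2}`, where `M` is the Hessian at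
the current point: `ρ ≤ A M A ≤ 2` and `A² ≤ 1 / ζ` as quadratic forms, with `A` symmetric and
onto. -/
structure IsPreconditioner {E : Type*} [NormedAddCommGroup E] [InnerProductSpace ℝ E]
    (M A : E →L[ℝ] E) (ρ ζ : ℝ) : Prop where
  symm : ∀ u v, ⟪A u, v⟫_ℝ = ⟪u, A v⟫_ℝ
  surj : Function.Surjective A
  lower : ∀ w, ρ * ‖w‖ ^ 2 ≤ ⟪M (A w), A w⟫_ℝ
  upper : ∀ w, ⟪M (A w), A w⟫_ℝ ≤ 2 * ‖w‖ ^ 2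
  norm_sq : ∀ w, ζ * ‖A w‖ ^ 2 ≤ ‖w‖ ^ 2

section Matrix

variable {d : ℕ}

lemma inner_toEuclideanCLM_nonneg {S : Matrix (Fin d) (Fin d) ℝ} (hS : S.PosSemidef)
    (v : EuclideanSpace ℝ (Fin d)) : 0 ≤ ⟪Matrix.toEuclideanCLM (𝕜 := ℝ) S v, v⟫_ℝ := by
  have := hS.dotProduct_mulVec_nonneg (WithLp.ofLp v)
  rw [EuclideanSpace.inner_eq_star_dotProduct]
  simpa using this

lemma isPreconditioner_invSqrt {f : EuclideanSpace ℝ (Fin d) → ℝ} {ρ ζ : ℝ} (hρ : 0 ≤ ρ)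
    (hζ : 0 < ζ) {x : EuclideanSpace ℝ (Fin d)} {H : Matrix (Fin d) (Fin d) ℝ}
    (hH : IsApproxHessian f ρ ζ x H) : IsPreconditioner (hessianOp f x) (invSqrt H) ρ ζ := by
  obtain ⟨h1, h2, h3⟩ := hH
  have hpd : H.PosDef := by
    have := Matrix.PosDef.posSemidef_add h3 ((Matrix.PosDef.one (n := Fin d) (R := ℝ)).smul hζ)
    simpa using this
  set S := CFC.sqrt H⁻¹ with hS
  have hS0 : S.PosSemidef := by
    rw [← Matrix.nonneg_iff_posSemidef]; exact CFC.sqrt_nonneg _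
  have hSS : S * S = H⁻¹ := CFC.sqrt_mul_sqrt_self _
    (Matrix.nonneg_iff_posSemidef.2 hpd.inv.posSemidef)
  have hdet : IsUnit H.det := (Matrix.isUnit_iff_isUnit_det H).1 hpd.isUnit
  -- `S (S H) = 1` makes `S H` a two-sided inverse of `S`, so commuting `S` with `H` is not needed.
  have hSHS : S * H * S = 1 := by
    refine mul_eq_one_comm.1 ?_
    rw [← mul_assoc, hSS, Matrix.nonsing_inv_mul H hdet]
  have symm : ∀ u v, ⟪invSqrt H u, v⟫_ℝ = ⟪u, invSqrt H v⟫_ℝ := by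
    intro u v
    have h : star (invSqrt H) = invSqrt H := by
      unfold invSqrt
      rw [← map_star, Matrix.star_eq_conjTranspose, hS0.isHermitian.eq]
    rw [← ContinuousLinearMap.adjoint_inner_left, ← ContinuousLinearMap.star_eq_adjoint, h]
  have hM : Matrix.toEuclideanCLM (n := Fin d) (𝕜 := ℝ) (hessian f x) = hessianOp f x := by
    simp [hessian]
  -- `⟪H A w, A w⟫ = ‖w‖²`
  have hHA : ∀ w, ⟪Matrix.toEuclideanCLM (n := Fin d) (𝕜 := ℝ) H (invSqrt H w), invSqrt H w⟫_ℝ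
      = ‖w‖ ^ 2 := by
    intro w
    rw [← symm]
    have : invSqrt H (Matrix.toEuclideanCLM (n := Fin d) (𝕜 := ℝ) H (invSqrt H w)) = w := by
      unfold invSqrt
      rw [← mul_apply_eq_comp, ← mul_apply_eq_comp, ← map_mul, ← map_mul,
        ← hS, hSHS, map_one]
      rfl
    rw [this, real_inner_self_eq_norm_sq]
  refine ⟨symm, fun v => ?_, fun w => ?_, fun w => ?_, fun w => ?_⟩
  · refine ⟨Matrix.toEuclideanCLM (n := Fin d) (𝕜 := ℝ) (S * H) v, ?_⟩
    have hone : S * (S * H) = 1 := by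
      rw [← mul_assoc, hSS, Matrix.nonsing_inv_mul H hdet]
    unfold invSqrt
    rw [← mul_apply_eq_comp, ← map_mul, ← hS, hone, map_one]
    rfl
  · have := inner_toEuclideanCLM_nonneg h1 (invSqrt H w)
    rw [map_sub, map_smul, hM, sub_apply, smul_apply,
      inner_sub_left, real_inner_smul_left, hHA] at this
    linarith
  · have := inner_toEuclideanCLM_nonneg h2 (invSqrt H w)
    rw [map_sub, map_smul, hM, sub_apply, smul_apply,
      inner_sub_left, real_inner_smul_left, hHA] at this
    nlinarith [sq_nonneg ‖w‖]
  · have := inner_toEuclideanCLM_nonneg h3 (invSqrt H w)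
    rw [map_sub, map_smul, map_one, sub_apply, smul_apply,
      inner_sub_left, real_inner_smul_left, hHA, one_apply_eq_self,
      real_inner_self_eq_norm_sq] at this
    linarith

end Matrix

/-! ### The preconditioned gradient dominates the optimality gap -/

section Domination

variable {d : ℕ} {f : EuclideanSpace ℝ (Fin d) → ℝ} {τ L γ ρ ζ : ℝ}
  {x xstar : EuclideanSpace ℝ (Fin d)}
  {A : EuclideanSpace ℝ (Fin d) →L[ℝ] EuclideanSpace ℝ (Fin d)}

/-- A Polyak–Łojasiewicz inequality in the metric of the preconditioner. With `r = x - x⋆ = A z`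
and `h = A ∇f(x)`, convexity bounds the gap by `D = ⟪∇f(x), r⟫ = ⟪h, z⟫ ≤ ‖h‖ ‖z‖`, while
`ρ ‖z‖² ≤ ⟪∇²f(x) r, r⟫` is at most `(67 / 64) D` near `x⋆`. -/
lemma mul_gap_le_norm_sq (hτ : 0 < τ) (hL : 0 < L) (hγ : 0 ≤ γ) (hρ : 0 < ρ) (hρ1 : ρ ≤ 1)
    (hζ : 0 < ζ) (hconv : StronglyConvex τ f) (hsmooth : LSmooth L f)
    (hhess : LipschitzHessian γ f) (hmin : ∀ y, f xstar ≤ f y)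
    (hA : IsPreconditioner (hessianOp f x) A ρ ζ)
    (hx : γ * ‖x - xstar‖ ≤ ρ * (3 * τ * √ζ / (64 * √L))) :
    ρ * (f x - f xstar) ≤ 67 / 64 * ‖A (∇ f x)‖ ^ 2 := by
  obtain ⟨z, hz⟩ := hA.surj (x - xstar)
  set r := x - xstar with hr
  set g := ∇ f x with hg
  set D := ⟪g, r⟫_ℝ with hD
  have hgap : f x - f xstar ≤ D := by
    have h := hconv.2 x xstar
    have : xstar - x = -r := by simp [hr]
    rw [this, inner_neg_right] at h
    have : 0 ≤ τ / 2 * ‖x - xstar‖ ^ 2 := by positivity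
    linarith
  have hτD : τ * ‖r‖ ^ 2 ≤ D := by
    have h := hconv.2 x xstar
    have h' := hconv.2 xstar x
    have : xstar - x = -r := by simp [hr]
    rw [this, inner_neg_right] at h
    rw [gradient_eq_zero_of_forall_le hmin, inner_zero_left, norm_sub_rev, ← hr] at h'
    rw [← hr] at h
    linarith
  have hD0 : 0 ≤ D := le_trans (by positivity) hτD
  have hlow := hA.lower z
  rw [hz] at hlow
  have hMr : ⟪hessianOp f x r, r⟫_ℝ ≤ D + γ * ‖r‖ ^ 3 := by
    have h := hhess.norm_gradient_sub_sub_le hγ x (-r)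
    have hx' : x + -r = xstar := by simp [hr]
    rw [hx', gradient_eq_zero_of_forall_le hmin, map_neg, norm_neg] at h
    have h2 : ⟪hessianOp f x r - g, r⟫_ℝ ≤ γ * ‖r‖ ^ 2 * ‖r‖ := by
      refine (real_inner_le_norm _ _).trans ?_
      gcongr
      rwa [show hessianOp f x r - g = 0 - g - -(hessianOp f x r) by abel]
    rw [inner_sub_left] at h2
    have : γ * ‖r‖ ^ 2 * ‖r‖ = γ * ‖r‖ ^ 3 := by ring
    linarith
  have hr3 : γ * ‖r‖ ^ 3 ≤ 3 / 64 * D := by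
    rcases eq_or_ne r 0 with h0 | h0
    · simpa [h0] using hD0
    have hrpos : 0 < ‖r‖ := norm_pos_iff.2 h0
    -- The radius in `hx` is at most `3 τ / (64 γ)`, because `ρ ζ ≤ ρ H ≤ ∇²f(x) ≤ L`.
    have hρζ : ρ * ζ ≤ L := by
      have h1 := hA.norm_sq z
      rw [hz] at h1
      have h2 : ⟪hessianOp f x r, r⟫_ℝ ≤ L * ‖r‖ ^ 2 := by
        calc _ ≤ ‖hessianOp f x r‖ * ‖r‖ := real_inner_le_norm _ _
          _ ≤ L * ‖r‖ * ‖r‖ := by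
            gcongr
            exact ContinuousLinearMap.le_of_opNorm_le _ (hsmooth.norm_hessianOp_le hL.le x) _
          _ = _ := by ring
      have h3 : ρ * ζ * ‖r‖ ^ 2 ≤ L * ‖r‖ ^ 2 := by nlinarith
      exact le_of_mul_le_mul_right h3 (by positivity)
    have hsq : ρ * √ζ ≤ √L := by
      have h1 : ρ * √ζ ≤ √(ρ * ζ) := by
        rw [Real.sqrt_mul hρ.le]
        gcongr
        exact Real.le_sqrt_of_sq_le (by nlinarith)
      exact h1.trans (Real.sqrt_le_sqrt hρζ)
    have hsL : 0 < √L := Real.sqrt_pos.2 hL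
    have h4 : γ * ‖r‖ ≤ 3 / 64 * τ := by
      refine hx.trans ?_
      have : ρ * (3 * τ * √ζ / (64 * √L)) = 3 / 64 * τ * (ρ * √ζ / √L) := by
        field_simp
      rw [this]
      have : ρ * √ζ / √L ≤ 1 := (div_le_one hsL).2 hsq
      have h5 : (0:ℝ) ≤ 3 / 64 * τ := by positivity
      nlinarith
    calc γ * ‖r‖ ^ 3 = γ * ‖r‖ * ‖r‖ ^ 2 := by ring
      _ ≤ 3 / 64 * τ * ‖r‖ ^ 2 := by gcongr
      _ ≤ 3 / 64 * D := by linarith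
  have hDz : D ≤ ‖A g‖ * ‖z‖ := by
    rw [hD, ← hz, ← hA.symm]
    exact real_inner_le_norm _ _
  have hz2 : ρ * ‖z‖ ^ 2 ≤ 67 / 64 * D := by linarith
  have hkey : ρ * D ≤ 67 / 64 * ‖A g‖ ^ 2 := by
    rcases hD0.eq_or_lt with h0 | h0
    · rw [← h0]; simp
    · have h1 : D ^ 2 ≤ ‖A g‖ ^ 2 * ‖z‖ ^ 2 := by
        rw [← mul_pow]; gcongr
      have h2 : ρ * D * D ≤ 67 / 64 * ‖A g‖ ^ 2 * D := by
        nlinarith [mul_le_mul_of_nonneg_left hz2 (sq_nonneg ‖A g‖),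
          mul_le_mul_of_nonneg_left h1 hρ.le]
      exact le_of_mul_le_mul_right h2 h0
  exact (mul_le_mul_of_nonneg_left hgap hρ.le).trans hkey

end Domination

/-! ### Moments of Gaussian vectors -/

lemma integrable_pow_gaussianReal (n : ℕ) :
    Integrable (fun x : ℝ => x ^ n) (gaussianReal 0 1) := by
  have h := memLp_id_gaussianReal' (μ := 0) (v := 1) (n : ENNReal) (by simp)
  exact (integrable_norm_iff (by fun_prop)).1 (by simpa using h.integrable_norm_pow' )

/-- Stein's identity for monomials. -/
lemma integral_pow_add_two_gaussianReal (n : ℕ) :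
    ∫ x, x ^ (n + 2) ∂(gaussianReal 0 1) = (n + 1) * ∫ x, x ^ n ∂(gaussianReal 0 1) := by
  have hint : ∀ k : ℕ, Integrable (fun x : ℝ => x ^ k * Real.exp (-(1 / 2) * x ^ 2)) := by
    intro k
    have := integrable_rpow_mul_exp_neg_mul_sq (b := 1 / 2) (by norm_num) (s := k)
      (by have : (0:ℝ) ≤ k := k.cast_nonneg
          linarith)
    simpa using this
  have key := integral_mul_deriv_eq_deriv_mul_of_integrable
    (u := fun x : ℝ => x ^ (n + 1)) (u' := fun x => (n + 1) * x ^ n)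
    (v := fun x : ℝ => -Real.exp (-(1 / 2) * x ^ 2))
    (v' := fun x => x * Real.exp (-(1 / 2) * x ^ 2))
    (fun x _ => by simpa using hasDerivAt_pow (n + 1) x)
    (fun x _ => by
      have := (((hasDerivAt_pow 2 x).const_mul (-(1 / 2 : ℝ))).exp).neg
      refine this.congr_deriv ?_
      push_cast; ring)
    (by refine (hint (n + 2)).congr (Filter.Eventually.of_forall fun x => ?_)
        simp only [Pi.mul_apply]; ring)
    (by refine ((hint n).const_mul (-(n + 1 : ℝ))).congr (Filter.Eventually.of_forall fun x => ?_)
        simp only [Pi.mul_apply]; ring)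
    (by refine (hint (n + 1)).neg.congr (Filter.Eventually.of_forall fun x => ?_)
        simp only [Pi.mul_apply, Pi.neg_apply]; ring)
  rw [integral_gaussianReal_eq_integral_smul one_ne_zero,
    integral_gaussianReal_eq_integral_smul one_ne_zero, ← integral_const_mul]
  have hpdf : ∀ x : ℝ, gaussianPDFReal 0 1 x = (√(2 * Real.pi))⁻¹ * Real.exp (-(1 / 2) * x ^ 2) := by
    intro x
    simp only [gaussianPDFReal, NNReal.coe_one, mul_one, sub_zero]
    congr 2; ring
  simp only [hpdf, smul_eq_mul]
  calc ∫ x : ℝ, (√(2 * Real.pi))⁻¹ * Real.exp (-(1 / 2) * x ^ 2) * x ^ (n + 2)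
      = (√(2 * Real.pi))⁻¹ * ∫ x : ℝ, x ^ (n + 1) * (x * Real.exp (-(1 / 2) * x ^ 2)) := by
        rw [← integral_const_mul]; congr 1; ext x; ring
    _ = (√(2 * Real.pi))⁻¹ * ∫ x : ℝ, -((n + 1) * x ^ n * -Real.exp (-(1 / 2) * x ^ 2)) := by
        rw [key, integral_neg]
    _ = _ := by rw [← integral_const_mul]; congr 1; ext x; ring

lemma integral_pow_even_gaussianReal (k : ℕ) :
    ∫ x, x ^ (2 * k) ∂(gaussianReal 0 1) = ∏ i ∈ Finset.range k, (2 * (i : ℝ) + 1) := by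
  induction k with
  | zero => simp
  | succ k ih =>
    rw [mul_add, mul_one, integral_pow_add_two_gaussianReal, ih, Finset.prod_range_succ]
    push_cast; ring

lemma integrable_sum_sq_pow (d k : ℕ) :
    Integrable (fun x : Fin d → ℝ => (∑ i, x i ^ 2) ^ k)
      (Measure.pi fun _ => gaussianReal 0 1) := by
  have h : MeasurePreserving (WithLp.toLp 2) (Measure.pi fun _ : Fin d => gaussianReal 0 1)
      (stdGaussian (EuclideanSpace ℝ (Fin d))) := ⟨by fun_prop, map_pi_eq_stdGaussian⟩
  have h2 : Integrable (fun u : EuclideanSpace ℝ (Fin d) => ‖u‖ ^ (2 * k))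
      (stdGaussian (EuclideanSpace ℝ (Fin d))) := by
    have := IsGaussian.memLp_id (stdGaussian (EuclideanSpace ℝ (Fin d)))
      ((2 * k : ℕ) : ENNReal) (ENNReal.natCast_ne_top _)
    simpa using this.integrable_norm_pow'
  refine (h.integrable_comp_of_integrable h2).congr (Filter.Eventually.of_forall fun x => ?_)
  simp [pow_mul, EuclideanSpace.norm_sq_eq]

/-- The moments of the chi-squared distribution, by induction on the dimension. -/
lemma integral_sum_sq_pow (d k : ℕ) (hk : k ≤ 5) :
    ∫ x : Fin d → ℝ, (∑ i, x i ^ 2) ^ k ∂(Measure.pi fun _ => gaussianReal 0 1)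
      = ∏ i ∈ Finset.range k, ((d : ℝ) + 2 * i) := by
  induction d generalizing k with
  | zero =>
    rcases k with _ | k
    · simp
    · simp [Finset.prod_range_succ']
  | succ d ih =>
    have hmp := measurePreserving_piFinSuccAbove (n := d) (α := fun _ => ℝ)
      (fun _ => gaussianReal 0 1) 0
    have hstep : ∫ x : Fin (d + 1) → ℝ, (∑ i, x i ^ 2) ^ k
          ∂(Measure.pi fun _ => gaussianReal 0 1)
        = ∫ z : ℝ × (Fin d → ℝ), (z.1 ^ 2 + ∑ i, z.2 i ^ 2) ^ k
          ∂((gaussianReal 0 1).prod (Measure.pi fun _ => gaussianReal 0 1)) := by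
      rw [← hmp.integral_comp (MeasurableEquiv.measurableEmbedding _)]
      congr 1; ext x
      simp [Fin.sum_univ_succ, MeasurableEquiv.piFinSuccAbove, Fin.tail]
    rw [hstep]
    simp only [add_pow]
    rw [integral_finsetSum]
    · have hterm : ∀ m ∈ Finset.range (k + 1),
          ∫ z : ℝ × (Fin d → ℝ), (z.1 ^ 2) ^ m * (∑ i, z.2 i ^ 2) ^ (k - m) * (k.choose m : ℝ)
            ∂((gaussianReal 0 1).prod (Measure.pi fun _ => gaussianReal 0 1))
          = (∏ i ∈ Finset.range m, (2 * (i : ℝ) + 1))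
            * (∏ i ∈ Finset.range (k - m), ((d : ℝ) + 2 * i)) * (k.choose m : ℝ) := by
        intro m _
        rw [integral_mul_const,
          integral_prod_mul (fun x : ℝ => (x ^ 2) ^ m)
            (fun y : Fin d → ℝ => (∑ i, y i ^ 2) ^ (k - m)), ih (k - m) (by omega)]
        simp only [← pow_mul, integral_pow_even_gaussianReal]
      rw [Finset.sum_congr rfl hterm]
      interval_cases k <;>
        simp [Finset.sum_range_succ, Finset.prod_range_succ, Nat.choose] <;> ring
    · intro m _
      refine Integrable.mul_const ?_ _
      refine Integrable.mul_prod (f := fun x : ℝ => (x ^ 2) ^ m)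
        (g := fun y : Fin d → ℝ => (∑ i, y i ^ 2) ^ (k - m)) ?_ (integrable_sum_sq_pow d _)
      simpa only [← pow_mul] using integrable_pow_gaussianReal (2 * m)

section Moments

variable {d : ℕ}

lemma integral_norm_pow_stdGaussian (k : ℕ) (hk : k ≤ 5) :
    ∫ u, ‖u‖ ^ (2 * k) ∂(stdGaussian (EuclideanSpace ℝ (Fin d)))
      = ∏ i ∈ Finset.range k, ((d : ℝ) + 2 * i) := by
  rw [← map_pi_eq_stdGaussian, integral_map (by fun_prop) (by fun_prop), ← integral_sum_sq_pow d k hk]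
  congr 1; ext x
  simp [pow_mul, EuclideanSpace.norm_sq_eq]

lemma integral_inner_pow_stdGaussian (h : EuclideanSpace ℝ (Fin d)) (k : ℕ) :
    ∫ u, ⟪h, u⟫_ℝ ^ (2 * k) ∂(stdGaussian (EuclideanSpace ℝ (Fin d)))
      = ‖h‖ ^ (2 * k) * ∏ i ∈ Finset.range k, (2 * (i : ℝ) + 1) := by
  have hmap : (stdGaussian (EuclideanSpace ℝ (Fin d))).map (innerSL ℝ h)
      = (gaussianReal 0 1).map (‖h‖ * ·) := by
    rw [IsGaussian.map_eq_gaussianReal, integral_strongDual_stdGaussian,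
      variance_dual_stdGaussian, gaussianReal_map_const_mul]
    congr 1
    · simp
    · ext; simp
  have h1 : ∫ u, ⟪h, u⟫_ℝ ^ (2 * k) ∂(stdGaussian (EuclideanSpace ℝ (Fin d)))
      = ∫ y, y ^ (2 * k) ∂((stdGaussian (EuclideanSpace ℝ (Fin d))).map (innerSL ℝ h)) := by
    rw [integral_map (by fun_prop) (by fun_prop)]
    rfl
  rw [h1, hmap, integral_map (by fun_prop) (by fun_prop)]
  simp only [mul_pow]
  rw [integral_const_mul, integral_pow_even_gaussianReal]

end Moments

/-! ### Continuous functions of polynomial growth -/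

/-- `ψ` is continuous and bounded by a polynomial in the norm. Such functions form an algebra and
are integrable against every Gaussian measure. -/
def PolyGrowth {E : Type*} [NormedAddCommGroup E] (ψ : E → ℝ) : Prop :=
  Continuous ψ ∧ ∃ (C : ℝ) (k : ℕ), ∀ u, |ψ u| ≤ C * (1 + ‖u‖) ^ k

namespace PolyGrowth

section Closure

variable {E : Type*} [NormedAddCommGroup E] {ψ χ : E → ℝ}

lemma norm : PolyGrowth fun u : E => ‖u‖ :=
  ⟨by fun_prop, 1, 1, fun u => by simp⟩

lemma inner_left {E : Type*} [NormedAddCommGroup E] [InnerProductSpace ℝ E] (h : E) :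
    PolyGrowth fun u : E => ⟪h, u⟫_ℝ :=
  ⟨by fun_prop, ‖h‖, 1, fun u => by
    refine (abs_real_inner_le_norm h u).trans ?_
    have := norm_nonneg h
    rw [pow_one]; nlinarith⟩

lemma mul (hψ : PolyGrowth ψ) (hχ : PolyGrowth χ) : PolyGrowth fun u => ψ u * χ u := by
  obtain ⟨hc, C, k, h⟩ := hψ
  obtain ⟨hc', C', k', h'⟩ := hχ
  refine ⟨hc.mul hc', C * C', k + k', fun u => ?_⟩
  calc |ψ u * χ u| = |ψ u| * |χ u| := abs_mul _ _
    _ ≤ (C * (1 + ‖u‖) ^ k) * (C' * (1 + ‖u‖) ^ k') :=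
      mul_le_mul (h u) (h' u) (abs_nonneg _) ((abs_nonneg _).trans (h u))
    _ = _ := by rw [pow_add]; ring

lemma const_mul (hψ : PolyGrowth ψ) (a : ℝ) : PolyGrowth fun u => a * ψ u := by
  obtain ⟨hc, C, k, h⟩ := hψ
  refine ⟨hc.const_mul a, |a| * C, k, fun u => ?_⟩
  rw [abs_mul, mul_assoc]
  exact mul_le_mul_of_nonneg_left (h u) (abs_nonneg a)

lemma abs (hψ : PolyGrowth ψ) : PolyGrowth fun u => |ψ u| := by
  obtain ⟨hc, C, k, h⟩ := hψ
  exact ⟨hc.abs, C, k, fun u => by rw [abs_abs]; exact h u⟩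

lemma pow (hψ : PolyGrowth ψ) (n : ℕ) : PolyGrowth fun u => ψ u ^ n := by
  induction n with
  | zero => exact ⟨hψ.1.pow 0, 1, 0, fun u => by simp⟩
  | succ n ih => simpa only [pow_succ] using ih.mul hψ

lemma integrable [NormedSpace ℝ E] [CompleteSpace E] [SecondCountableTopology E]
    [MeasurableSpace E] [BorelSpace E] (hψ : PolyGrowth ψ) {ν : Measure E} [IsGaussian ν] :
    Integrable ψ ν := by
  obtain ⟨hc, C, k, h⟩ := hψ
  have hid : MemLp id (k : ENNReal) ν := IsGaussian.memLp_id ν k (ENNReal.natCast_ne_top k)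
  have hone : MemLp (fun _ : E => (1 : ℝ)) (k : ENNReal) ν := memLp_const 1
  have h1 : MemLp (fun u : E => 1 + ‖u‖) (k : ENNReal) ν := hone.add hid.norm
  have h2 : Integrable (fun u : E => C * (1 + ‖u‖) ^ k) ν := by
    have h3 := h1.integrable_norm_pow'
    refine (h3.const_mul C).congr (Filter.Eventually.of_forall fun u => ?_)
    have : 0 ≤ 1 + ‖u‖ := by positivity
    simp only [Real.norm_of_nonneg this]
  exact h2.mono' hc.aestronglyMeasurable (Filter.Eventually.of_forall h)

end Closure

end PolyGrowth

/-! ### A perturbed Gaussian linear sample -/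

section Sample

variable {d : ℕ} {c : EuclideanSpace ℝ (Fin d) → ℝ} {h : EuclideanSpace ℝ (Fin d)} {l : ℝ}

/-- `c` is continuous and differs from the linear form `⟪h, ·⟫` by at most `l ‖u‖²`. The
finite-difference coefficient `(f(x + μ A u) - f(x)) / μ` is of this kind with `h = A ∇f(x)`. -/
structure NearLinear (c : EuclideanSpace ℝ (Fin d) → ℝ) (h : EuclideanSpace ℝ (Fin d)) (l : ℝ) :
    Prop where
  continuous : Continuous c
  nonneg : 0 ≤ l
  abs_sub_le : ∀ u, |c u - ⟪h, u⟫_ℝ| ≤ l * ‖u‖ ^ 2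

namespace NearLinear

lemma polyGrowth (hc : NearLinear c h l) : PolyGrowth c := by
  refine ⟨hc.continuous, ‖h‖ + l, 2, fun u => ?_⟩
  have h1 := hc.abs_sub_le u
  have h2 := abs_real_inner_le_norm h u
  have h3 : |c u| ≤ |c u - ⟪h, u⟫_ℝ| + |⟪h, u⟫_ℝ| := by
    simpa using abs_add_le (c u - ⟪h, u⟫_ℝ) ⟪h, u⟫_ℝ
  have := hc.nonneg
  have := norm_nonneg h
  have := norm_nonneg u
  nlinarith [mul_nonneg this hc.nonneg, mul_nonneg (norm_nonneg h) (sq_nonneg ‖u‖),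
    mul_nonneg (norm_nonneg h) this]

lemma sq_sub_le (hc : NearLinear c h l) (u : EuclideanSpace ℝ (Fin d)) :
    (c u - ⟪h, u⟫_ℝ) ^ 2 ≤ l ^ 2 * ‖u‖ ^ 4 := by
  calc (c u - ⟪h, u⟫_ℝ) ^ 2 = |c u - ⟪h, u⟫_ℝ| ^ 2 := (sq_abs _).symm
    _ ≤ (l * ‖u‖ ^ 2) ^ 2 := by gcongr; exact hc.abs_sub_le u
    _ = _ := by ring

lemma sq_le (hc : NearLinear c h l) (u : EuclideanSpace ℝ (Fin d)) :
    c u ^ 2 ≤ 2 * ⟪h, u⟫_ℝ ^ 2 + 2 * (l ^ 2 * ‖u‖ ^ 4) := by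
  nlinarith [hc.sq_sub_le u, sq_nonneg (c u - 2 * ⟪h, u⟫_ℝ)]

end NearLinear

local notation "P" => stdGaussian (EuclideanSpace ℝ (Fin d))

lemma integral_inner_sq : ∫ u, ⟪h, u⟫_ℝ ^ 2 ∂P = ‖h‖ ^ 2 := by
  simpa using integral_inner_pow_stdGaussian h 1

lemma integral_inner_pow_four : ∫ u, ⟪h, u⟫_ℝ ^ 4 ∂P = 3 * ‖h‖ ^ 4 := by
  have := integral_inner_pow_stdGaussian h 2
  norm_num [Finset.prod_range_succ] at this
  linarith

lemma integral_inner_pow_six : ∫ u, ⟪h, u⟫_ℝ ^ 6 ∂P = 15 * ‖h‖ ^ 6 := by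
  have := integral_inner_pow_stdGaussian h 3
  norm_num [Finset.prod_range_succ] at this
  linarith

lemma integral_norm_pow_four : ∫ u, ‖u‖ ^ 4 ∂P = (d : ℝ) * (d + 2) := by
  have := integral_norm_pow_stdGaussian (d := d) 2 (by norm_num)
  simpa [Finset.prod_range_succ] using this

lemma integral_norm_pow_six : ∫ u, ‖u‖ ^ 6 ∂P = (d : ℝ) * (d + 2) * (d + 4) := by
  have := integral_norm_pow_stdGaussian (d := d) 3 (by norm_num)
  norm_num [Finset.prod_range_succ] at this
  exact this

lemma integral_norm_pow_eight : ∫ u, ‖u‖ ^ 8 ∂P = (d : ℝ) * (d + 2) * (d + 4) * (d + 6) := by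
  have := integral_norm_pow_stdGaussian (d := d) 4 (by norm_num)
  norm_num [Finset.prod_range_succ] at this
  exact this

lemma integral_norm_pow_ten :
    ∫ u, ‖u‖ ^ 10 ∂P = (d : ℝ) * (d + 2) * (d + 4) * (d + 6) * (d + 8) := by
  have := integral_norm_pow_stdGaussian (d := d) 5 (by norm_num)
  norm_num [Finset.prod_range_succ] at this
  exact this

/-- Interpolation between the eighth and the tenth moment. -/
lemma integral_norm_pow_nine_le :
    ∫ u, ‖u‖ ^ 9 ∂P ≤ (d : ℝ) * (d + 2) * (d + 4) * (d + 6) * √((d : ℝ) + 8) := by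
  set a := √((d : ℝ) + 8) with ha
  have ha0 : 0 < a := Real.sqrt_pos.2 (by positivity)
  have ha2 : a ^ 2 = d + 8 := Real.sq_sqrt (by positivity)
  have hmono : ∫ u, 2 * a * ‖u‖ ^ 9 ∂P ≤ ∫ u, (a ^ 2 * ‖u‖ ^ 8 + ‖u‖ ^ 10) ∂P := by
    refine integral_mono ((PolyGrowth.norm.pow 9).const_mul _).integrable
      (((PolyGrowth.norm.pow 8).const_mul _).integrable.add (PolyGrowth.norm.pow 10).integrable)
      fun u => ?_
    have : 0 ≤ ‖u‖ ^ 8 * (a - ‖u‖) ^ 2 := by positivity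
    simp only
    linarith
  rw [integral_const_mul, integral_add ((PolyGrowth.norm.pow 8).const_mul _).integrable
    (PolyGrowth.norm.pow 10).integrable, integral_const_mul, integral_norm_pow_eight,
    integral_norm_pow_ten, ha2] at hmono
  have h9 : 2 * a * ∫ u, ‖u‖ ^ 9 ∂P ≤ 2 * a * ((d : ℝ) * (d + 2) * (d + 4) * (d + 6) * a) := by
    refine hmono.trans (le_of_eq ?_)
    rw [← ha2]
    ring
  exact le_of_mul_le_mul_left h9 (by positivity)

/-- By weighted arithmetic-geometric means from the fourth moments; the constant `2` instead of the
exact `1` is affordable. -/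
lemma integral_inner_sq_mul_norm_sq_le :
    ∫ u, ⟪h, u⟫_ℝ ^ 2 * ‖u‖ ^ 2 ∂P ≤ 2 * ((d : ℝ) + 2) * ‖h‖ ^ 2 := by
  rcases eq_or_ne h 0 with rfl | h0
  · simp
  have hpos : 0 < ‖h‖ := norm_pos_iff.2 h0
  have hI := PolyGrowth.inner_left h
  have hN := PolyGrowth.norm (E := EuclideanSpace ℝ (Fin d))
  have hmono : ∫ u, 2 * (‖h‖ ^ 2 * ((d : ℝ) + 2)) * (⟪h, u⟫_ℝ ^ 2 * ‖u‖ ^ 2) ∂P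
      ≤ ∫ u, (((d : ℝ) + 2) ^ 2 * ⟪h, u⟫_ℝ ^ 4 + ‖h‖ ^ 4 * ‖u‖ ^ 4) ∂P := by
    refine integral_mono (((hI.pow 2).mul (hN.pow 2)).const_mul _).integrable
      (((hI.pow 4).const_mul _).integrable.add ((hN.pow 4).const_mul _).integrable)
      fun u => ?_
    have : 0 ≤ (((d : ℝ) + 2) * ⟪h, u⟫_ℝ ^ 2 - ‖h‖ ^ 2 * ‖u‖ ^ 2) ^ 2 := sq_nonneg _
    simp only
    linarith
  rw [integral_const_mul, integral_add ((hI.pow 4).const_mul _).integrable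
    ((hN.pow 4).const_mul _).integrable, integral_const_mul, integral_const_mul,
    integral_inner_pow_four, integral_norm_pow_four] at hmono
  refine le_of_mul_le_mul_left (a := 2 * (‖h‖ ^ 2 * ((d : ℝ) + 2))) (hmono.trans ?_)
    (by positivity)
  have : 0 ≤ ‖h‖ ^ 4 * ((d : ℝ) + 2) := by positivity
  nlinarith

/-- By weighted arithmetic-geometric means from the sixth moments, which gives the order
`(d + 2)^{3/2}`; the pointwise bound `|⟪h, u⟫| ≤ ‖h‖ ‖u‖` would lose a factor `√d`. -/
lemma integral_abs_inner_pow_three_mul_norm_le {q : ℝ} (hq : 0 < q) (hq2 : q ^ 2 = d + 2) :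
    ∫ u, |⟪h, u⟫_ℝ| ^ 3 * ‖u‖ ^ 3 ∂P ≤ 8 * q ^ 3 * ‖h‖ ^ 3 := by
  rcases eq_or_ne h 0 with rfl | h0
  · simp
  have hpos : 0 < ‖h‖ := norm_pos_iff.2 h0
  have hI := PolyGrowth.inner_left h
  have hN := PolyGrowth.norm (E := EuclideanSpace ℝ (Fin d))
  have hmono : ∫ u, 2 * (‖h‖ ^ 3 * q ^ 3) * (|⟪h, u⟫_ℝ| ^ 3 * ‖u‖ ^ 3) ∂P
      ≤ ∫ u, (q ^ 6 * ⟪h, u⟫_ℝ ^ 6 + ‖h‖ ^ 6 * ‖u‖ ^ 6) ∂P := by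
    refine integral_mono (((hI.abs.pow 3).mul (hN.pow 3)).const_mul _).integrable
      (((hI.pow 6).const_mul _).integrable.add ((hN.pow 6).const_mul _).integrable)
      fun u => ?_
    have h1 : 0 ≤ (q ^ 3 * |⟪h, u⟫_ℝ| ^ 3 - ‖h‖ ^ 3 * ‖u‖ ^ 3) ^ 2 := sq_nonneg _
    have h2 : ⟪h, u⟫_ℝ ^ 6 = |⟪h, u⟫_ℝ| ^ 6 := (Even.pow_abs (by decide) _).symm
    simp only [h2]
    linarith
  rw [integral_const_mul, integral_add ((hI.pow 6).const_mul _).integrable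
    ((hN.pow 6).const_mul _).integrable, integral_const_mul, integral_const_mul,
    integral_inner_pow_six, integral_norm_pow_six] at hmono
  refine le_of_mul_le_mul_left (a := 2 * (‖h‖ ^ 3 * q ^ 3)) (hmono.trans ?_)
    (by positivity)
  have hd : (d : ℝ) * (d + 2) * (d + 4) ≤ q ^ 6 := by
    rw [show q ^ 6 = (q ^ 2) ^ 3 by ring, hq2]
    have : (0 : ℝ) ≤ d := d.cast_nonneg
    nlinarith
  calc _ ≤ q ^ 6 * (15 * ‖h‖ ^ 6) + ‖h‖ ^ 6 * q ^ 6 := by gcongr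
    _ = _ := by ring

namespace NearLinear

lemma le_integral_mul_inner (hc : NearLinear c h l) :
    7 / 8 * ‖h‖ ^ 2 - 2 * l ^ 2 * ((d : ℝ) * (d + 2)) ≤ ∫ u, c u * ⟪h, u⟫_ℝ ∂P := by
  have hI := PolyGrowth.inner_left h
  have hN := PolyGrowth.norm (E := EuclideanSpace ℝ (Fin d))
  have hmono : ∫ u, (7 / 8 * ⟪h, u⟫_ℝ ^ 2 - 2 * l ^ 2 * ‖u‖ ^ 4) ∂P
      ≤ ∫ u, c u * ⟪h, u⟫_ℝ ∂P := by
    refine integral_mono (((hI.pow 2).const_mul _).integrable.sub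
      ((hN.pow 4).const_mul _).integrable) (hc.polyGrowth.mul hI).integrable fun u => ?_
    have h1 := hc.sq_sub_le u
    have h2 := sq_nonneg (⟪h, u⟫_ℝ + 4 * (c u - ⟪h, u⟫_ℝ))
    simp only
    nlinarith
  rwa [integral_sub ((hI.pow 2).const_mul _).integrable ((hN.pow 4).const_mul _).integrable,
    integral_const_mul, integral_const_mul, integral_inner_sq, integral_norm_pow_four] at hmono

lemma integral_sq_le (hc : NearLinear c h l) :
    ∫ u, c u ^ 2 ∂P ≤ 2 * ‖h‖ ^ 2 + 2 * l ^ 2 * ((d : ℝ) * (d + 2)) := by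
  have hI := PolyGrowth.inner_left h
  have hN := PolyGrowth.norm (E := EuclideanSpace ℝ (Fin d))
  have hmono : ∫ u, c u ^ 2 ∂P ≤ ∫ u, (2 * ⟪h, u⟫_ℝ ^ 2 + 2 * l ^ 2 * ‖u‖ ^ 4) ∂P := by
    refine integral_mono (hc.polyGrowth.pow 2).integrable
      (((hI.pow 2).const_mul _).integrable.add ((hN.pow 4).const_mul _).integrable) fun u => ?_
    have h1 := hc.sq_le u
    simp only
    linarith
  rwa [integral_add ((hI.pow 2).const_mul _).integrable ((hN.pow 4).const_mul _).integrable,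
    integral_const_mul, integral_const_mul, integral_inner_sq, integral_norm_pow_four] at hmono

lemma integral_norm_smul_sq_le (hc : NearLinear c h l) :
    ∫ u, ‖c u • u‖ ^ 2 ∂P
      ≤ 4 * ((d : ℝ) + 2) * ‖h‖ ^ 2 + 2 * l ^ 2 * ((d : ℝ) * (d + 2) * (d + 4)) := by
  have hI := PolyGrowth.inner_left h
  have hN := PolyGrowth.norm (E := EuclideanSpace ℝ (Fin d))
  simp only [norm_smul, Real.norm_eq_abs, mul_pow, sq_abs]
  have hmono : ∫ u, c u ^ 2 * ‖u‖ ^ 2 ∂P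
      ≤ ∫ u, (2 * (⟪h, u⟫_ℝ ^ 2 * ‖u‖ ^ 2) + 2 * l ^ 2 * ‖u‖ ^ 6) ∂P := by
    refine integral_mono ((hc.polyGrowth.pow 2).mul (hN.pow 2)).integrable
      ((((hI.pow 2).mul (hN.pow 2)).const_mul _).integrable.add
        ((hN.pow 6).const_mul _).integrable) fun u => ?_
    have h1 := mul_le_mul_of_nonneg_right (hc.sq_le u) (sq_nonneg ‖u‖)
    simp only
    linarith
  rw [integral_add (((hI.pow 2).mul (hN.pow 2)).const_mul _).integrable
    ((hN.pow 6).const_mul _).integrable, integral_const_mul, integral_const_mul,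
    integral_norm_pow_six] at hmono
  linarith [integral_inner_sq_mul_norm_sq_le (h := h)]

lemma integral_norm_smul_pow_three_le (hc : NearLinear c h l) {q : ℝ} (hq : 0 < q)
    (hq2 : q ^ 2 = d + 2) :
    ∫ u, ‖c u • u‖ ^ 3 ∂P ≤ 32 * q ^ 3 * ‖h‖ ^ 3
      + 4 * l ^ 3 * ((d : ℝ) * (d + 2) * (d + 4) * (d + 6) * √((d : ℝ) + 8)) := by
  have hI := PolyGrowth.inner_left h
  have hN := PolyGrowth.norm (E := EuclideanSpace ℝ (Fin d))
  simp only [norm_smul, Real.norm_eq_abs, mul_pow]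
  have hmono : ∫ u, |c u| ^ 3 * ‖u‖ ^ 3 ∂P
      ≤ ∫ u, (4 * (|⟪h, u⟫_ℝ| ^ 3 * ‖u‖ ^ 3) + 4 * l ^ 3 * ‖u‖ ^ 9) ∂P := by
    refine integral_mono ((hc.polyGrowth.abs.pow 3).mul (hN.pow 3)).integrable
      ((((hI.abs.pow 3).mul (hN.pow 3)).const_mul _).integrable.add
        ((hN.pow 9).const_mul _).integrable) fun u => ?_
    have h1 : |c u| ≤ |⟪h, u⟫_ℝ| + l * ‖u‖ ^ 2 := by
      have := abs_add_le ⟪h, u⟫_ℝ (c u - ⟪h, u⟫_ℝ)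
      rw [add_sub_cancel] at this
      linarith [hc.abs_sub_le u]
    have h2 : |c u| ^ 3 ≤ 4 * (|⟪h, u⟫_ℝ| ^ 3 + (l * ‖u‖ ^ 2) ^ 3) := by
      have := add_pow_le (abs_nonneg ⟪h, u⟫_ℝ) (mul_nonneg hc.nonneg (sq_nonneg ‖u‖)) 3
      norm_num at this
      exact (pow_le_pow_left₀ (abs_nonneg _) h1 3).trans this
    have h3 := mul_le_mul_of_nonneg_right h2 (pow_nonneg (norm_nonneg u) 3)
    simp only
    linarith
  rw [integral_add (((hI.abs.pow 3).mul (hN.pow 3)).const_mul _).integrable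
    ((hN.pow 9).const_mul _).integrable, integral_const_mul, integral_const_mul] at hmono
  have h9 := mul_le_mul_of_nonneg_left (integral_norm_pow_nine_le (d := d))
    (show 0 ≤ 4 * l ^ 3 by have := hc.nonneg; positivity)
  linarith [integral_abs_inner_pow_three_mul_norm_le (h := h) hq hq2]

/-- The mean of `c(u) u` is controlled by `E c²` alone, without a dimension factor, since its
inner product with a vector `m` is `E c ⟪m, u⟫ ≤ (E c² + ‖m‖²) / 2`. -/
lemma norm_integral_smul_sq_le (hc : NearLinear c h l) :
    ‖∫ u, c u • u ∂P‖ ^ 2 ≤ ∫ u, c u ^ 2 ∂P := by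
  set m := ∫ u, c u • u ∂P with hm
  have hint : Integrable (fun u => c u • u) P := by
    refine (integrable_norm_iff (Continuous.aestronglyMeasurable
      (f := fun u => c u • u) (hc.continuous.smul continuous_id))).1 ?_
    simpa only [norm_smul, Real.norm_eq_abs] using
      (hc.polyGrowth.abs.mul PolyGrowth.norm).integrable (ν := P)
  have hI := PolyGrowth.inner_left m
  have h1 : ‖m‖ ^ 2 = ∫ u, c u * ⟪m, u⟫_ℝ ∂P := by
    rw [← real_inner_self_eq_norm_sq]
    nth_rw 2 [hm]
    rw [← integral_inner hint]
    simp only [inner_smul_right]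
  have h2 : ∫ u, c u * ⟪m, u⟫_ℝ ∂P ≤ ∫ u, (1 / 2 * c u ^ 2 + 1 / 2 * ⟪m, u⟫_ℝ ^ 2) ∂P := by
    refine integral_mono (hc.polyGrowth.mul hI).integrable
      (((hc.polyGrowth.pow 2).const_mul _).integrable.add
        ((hI.pow 2).const_mul _).integrable) fun u => ?_
    simp only
    nlinarith [sq_nonneg (c u - ⟪m, u⟫_ℝ)]
  rw [integral_add ((hc.polyGrowth.pow 2).const_mul _).integrable
        ((hI.pow 2).const_mul _).integrable, integral_const_mul, integral_const_mul,
        integral_inner_sq] at h2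
  linarith

end NearLinear

end Sample

/-! ### Sums over a batch of independent samples -/

section BatchSums

variable {d b : ℕ}

local notation "P" => stdGaussian (EuclideanSpace ℝ (Fin d))

lemma measurePreserving_eval_batchLaw (i : Fin b) :
    MeasurePreserving (fun u : Batch d b => u i) (batchLaw d b) P :=
  measurePreserving_eval (fun _ : Fin b => P) i

lemma PolyGrowth.integrable_eval {ψ : EuclideanSpace ℝ (Fin d) → ℝ} (hψ : PolyGrowth ψ)
    (i : Fin b) : Integrable (fun u : Batch d b => ψ (u i)) (batchLaw d b) :=
  (measurePreserving_eval_batchLaw i).integrable_comp_of_integrable hψ.integrable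

lemma integral_eval_batchLaw {ψ : EuclideanSpace ℝ (Fin d) → ℝ} (hψ : Continuous ψ) (i : Fin b) :
    ∫ u : Batch d b, ψ (u i) ∂(batchLaw d b) = ∫ u, ψ u ∂P := by
  rw [← (measurePreserving_eval_batchLaw (d := d) i).map_eq,
    integral_map (measurable_pi_apply i).aemeasurable hψ.aestronglyMeasurable]

instance isProbabilityMeasure_batchLaw : IsProbabilityMeasure (batchLaw d b) := by
  unfold batchLaw; infer_instance

/-- The second moment of a sum of i.i.d. vectors, by bias and variance in each coordinate. -/
lemma integral_norm_sum_sq_le {X : EuclideanSpace ℝ (Fin d) → EuclideanSpace ℝ (Fin d)}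
    (hX : Continuous X) (hXg : PolyGrowth fun u => ‖X u‖) :
    ∫ u : Batch d b, ‖∑ i, X (u i)‖ ^ 2 ∂(batchLaw d b)
      ≤ b * ∫ u, ‖X u‖ ^ 2 ∂P + (b : ℝ) ^ 2 * ‖∫ u, X u ∂P‖ ^ 2 := by
  have hXint : Integrable X P := (integrable_norm_iff hX.aestronglyMeasurable).1 hXg.integrable
  have hcont : ∀ k, Continuous fun u => X u k := fun k => by fun_prop
  have hL2 : ∀ k, MemLp (fun u => X u k) 2 P := fun k => by
    refine (memLp_two_iff_integrable_sq (hcont k).aestronglyMeasurable).2 ?_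
    refine (hXg.pow 2).integrable.mono' ((hcont k).pow 2).aestronglyMeasurable
      (Filter.Eventually.of_forall fun u => ?_)
    rw [Real.norm_of_nonneg (sq_nonneg _), ← sq_abs]
    gcongr
    exact PiLp.norm_apply_le (X u) k
  have hL2b : ∀ k i, MemLp (fun u : Batch d b => X (u i) k) 2 (batchLaw d b) := fun k i =>
    (hL2 k).comp_measurePreserving (measurePreserving_eval_batchLaw i)
  have hsum : ∀ k, MemLp (fun u : Batch d b => ∑ i, X (u i) k) 2 (batchLaw d b) := fun k =>
    memLp_finsetSum _ fun i _ => hL2b k i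
  have hcoord : ∀ k, ∫ u : Batch d b, (∑ i, X (u i) k) ^ 2 ∂(batchLaw d b)
      ≤ b * ∫ u, X u k ^ 2 ∂P + (b : ℝ) ^ 2 * (∫ u, X u ∂P) k ^ 2 := by
    intro k
    have hvar := variance_eq_sub (hsum k)
    have hvar2 : Var[fun u : Batch d b => ∑ i, X (u i) k; batchLaw d b]
        = ∑ _i : Fin b, Var[fun u => X u k; P] := by
      rw [← variance_sum_pi (fun _ : Fin b => hL2 k)]
      congr 1
      ext u; simp
    have hmean : ∫ u : Batch d b, ∑ i, X (u i) k ∂(batchLaw d b) = b * (∫ u, X u ∂P) k := by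
      rw [integral_finsetSum _ fun i _ => (hL2b k i).integrable (by norm_num)]
      simp only [integral_eval_batchLaw (hcont k)]
      have : (∫ u, X u ∂P) k = ∫ u, X u k ∂P :=
        ((EuclideanSpace.proj (𝕜 := ℝ) k).integral_comp_comm hXint).symm
      rw [this]; simp
    have hle := variance_le_expectation_sq (hcont k).aestronglyMeasurable (μ := P)
    simp only [Pi.pow_apply] at hvar hle
    rw [hvar2, hmean] at hvar
    simp only [Finset.sum_const, Finset.card_univ, Fintype.card_fin, nsmul_eq_mul] at hvar
    have := mul_le_mul_of_nonneg_left hle (b.cast_nonneg (α := ℝ))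
    linarith
  -- The squared norms are sums over the coordinates.
  have hlhs : ∫ u : Batch d b, ‖∑ i, X (u i)‖ ^ 2 ∂(batchLaw d b)
      = ∑ k, ∫ u : Batch d b, (∑ i, X (u i) k) ^ 2 ∂(batchLaw d b) := by
    rw [← integral_finsetSum _ fun k _ => (hsum k).integrable_sq]
    congr 1; ext u
    rw [EuclideanSpace.norm_sq_eq]
    simp
  have hrhs : ∫ u, ‖X u‖ ^ 2 ∂P = ∑ k, ∫ u, X u k ^ 2 ∂P := by
    rw [← integral_finsetSum _ fun k _ => (hL2 k).integrable_sq]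
    congr 1; ext u
    rw [EuclideanSpace.norm_sq_eq]
    simp
  rw [hlhs, hrhs, EuclideanSpace.norm_sq_eq, Finset.mul_sum, Finset.mul_sum,
    ← Finset.sum_add_distrib]
  refine Finset.sum_le_sum fun k _ => ?_
  simpa using hcoord k

lemma norm_sum_pow_le {E : Type*} [SeminormedAddCommGroup E] (v : Fin b → E) (n : ℕ) :
    ‖∑ i, v i‖ ^ (n + 1) ≤ (b : ℝ) ^ n * ∑ i, ‖v i‖ ^ (n + 1) := by
  rcases b.eq_zero_or_pos with rfl | hb
  · simp
  have h := pow_sum_div_card_le_sum_pow (s := Finset.univ) (f := fun i => ‖v i‖)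
    (fun i _ => norm_nonneg _) n
  rw [Finset.card_univ, Fintype.card_fin, div_le_iff₀ (by positivity)] at h
  calc _ ≤ (∑ i, ‖v i‖) ^ (n + 1) := by gcongr; exact norm_sum_le _ _
    _ ≤ _ := h
    _ = _ := mul_comm _ _

lemma integrable_norm_sum_pow {X : EuclideanSpace ℝ (Fin d) → EuclideanSpace ℝ (Fin d)}
    (hX : Continuous X) (hXg : PolyGrowth fun u => ‖X u‖) (n : ℕ) :
    Integrable (fun u : Batch d b => ‖∑ i, X (u i)‖ ^ (n + 1)) (batchLaw d b) := by
  have hdom : Integrable (fun u : Batch d b => (b : ℝ) ^ n * ∑ i, ‖X (u i)‖ ^ (n + 1))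
      (batchLaw d b) :=
    (integrable_finsetSum _ fun i _ => (hXg.pow (n + 1)).integrable_eval i).const_mul _
  refine hdom.mono' (Continuous.aestronglyMeasurable (by fun_prop))
    (Filter.Eventually.of_forall fun u => ?_)
  rw [Real.norm_of_nonneg (by positivity)]
  exact norm_sum_pow_le _ n

lemma integral_norm_sum_pow_le {X : EuclideanSpace ℝ (Fin d) → EuclideanSpace ℝ (Fin d)}
    (hX : Continuous X) (hXg : PolyGrowth fun u => ‖X u‖) (n : ℕ) :
    ∫ u : Batch d b, ‖∑ i, X (u i)‖ ^ (n + 1) ∂(batchLaw d b)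
      ≤ (b : ℝ) ^ (n + 1) * ∫ u, ‖X u‖ ^ (n + 1) ∂P := by
  have hint : ∀ i ∈ Finset.univ, Integrable (fun u : Batch d b => ‖X (u i)‖ ^ (n + 1))
      (batchLaw d b) := fun i _ => (hXg.pow (n + 1)).integrable_eval i
  calc _ ≤ ∫ u : Batch d b, (b : ℝ) ^ n * ∑ i, ‖X (u i)‖ ^ (n + 1) ∂(batchLaw d b) :=
        integral_mono (integrable_norm_sum_pow hX hXg n)
          ((integrable_finsetSum _ hint).const_mul _) fun u => norm_sum_pow_le _ n
    _ = _ := by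
        rw [integral_const_mul, integral_finsetSum _ hint]
        have : ∀ i : Fin b, ∫ u : Batch d b, ‖X (u i)‖ ^ (n + 1) ∂(batchLaw d b)
            = ∫ u, ‖X u‖ ^ (n + 1) ∂P := integral_eval_batchLaw (hX.norm.pow (n + 1))
        simp only [this, Finset.sum_const, Finset.card_univ, Fintype.card_fin, nsmul_eq_mul]
        ring

end BatchSums

/-! ### One step of the algorithm -/

section Step

variable {d b : ℕ} {f : EuclideanSpace ℝ (Fin d) → ℝ} {τ L γ ρ ζ μ : ℝ}
  {x xstar : EuclideanSpace ℝ (Fin d)}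
  {A : EuclideanSpace ℝ (Fin d) →L[ℝ] EuclideanSpace ℝ (Fin d)}

/-- The finite-difference quotient of `f` at `x` along `A u`. -/
noncomputable def diffQuotient (f : EuclideanSpace ℝ (Fin d) → ℝ) (μ : ℝ)
    (A : EuclideanSpace ℝ (Fin d) →L[ℝ] EuclideanSpace ℝ (Fin d))
    (x u : EuclideanSpace ℝ (Fin d)) : ℝ :=
  (f (x + μ • A u) - f x) / μ

/-- The sum `∑ᵢ c(uᵢ) uᵢ` over a batch, `c` being the difference quotient; the search direction
is `A` applied to it, divided by `b`. -/
noncomputable def batchSum (f : EuclideanSpace ℝ (Fin d) → ℝ) (μ : ℝ)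
    (A : EuclideanSpace ℝ (Fin d) →L[ℝ] EuclideanSpace ℝ (Fin d))
    (x : EuclideanSpace ℝ (Fin d)) (u : Batch d b) : EuclideanSpace ℝ (Fin d) :=
  ∑ i, diffQuotient f μ A x (u i) • u i

lemma direction_eq (H : Matrix (Fin d) (Fin d) ℝ) (u : Batch d b) :
    direction f μ H x u = (1 / (b : ℝ)) • invSqrt H (batchSum f μ (invSqrt H) x u) := by
  simp [direction, batchSum, diffQuotient, map_sum, map_smul]

lemma nearLinear_diffQuotient (hL : 0 ≤ L) (hμ : 0 < μ) (hζ : 0 < ζ) (hsmooth : LSmooth L f)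
    (hA : IsPreconditioner (hessianOp f x) A ρ ζ) :
    NearLinear (diffQuotient f μ A x) (A (∇ f x)) (L * μ / (2 * ζ)) where
  continuous := by
    have := hsmooth.1.continuous
    unfold diffQuotient
    fun_prop
  nonneg := by positivity
  abs_sub_le u := by
    have h1 := hsmooth.abs_sub_sub_inner_le x (μ • A u)
    rw [inner_smul_right, ← hA.symm, norm_smul, Real.norm_of_nonneg hμ.le] at h1
    have h2 : diffQuotient f μ A x u - ⟪A (∇ f x), u⟫_ℝ
        = (f (x + μ • A u) - f x - μ * ⟪A (∇ f x), u⟫_ℝ) / μ := by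
      unfold diffQuotient; field_simp
    rw [h2, abs_div, abs_of_pos hμ, div_le_iff₀ hμ]
    have h3 : ‖A u‖ ^ 2 ≤ ‖u‖ ^ 2 / ζ := (le_div_iff₀' hζ).2 (hA.norm_sq u)
    calc _ ≤ _ := h1
      _ = L / 2 * μ ^ 2 * ‖A u‖ ^ 2 := by ring
      _ ≤ L / 2 * μ ^ 2 * (‖u‖ ^ 2 / ζ) := by gcongr
      _ = _ := by field_simp

lemma IsPreconditioner.sqrt_mul_norm_le {M : EuclideanSpace ℝ (Fin d) →L[ℝ] EuclideanSpace ℝ (Fin d)}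
    (hA : IsPreconditioner M A ρ ζ) (w : EuclideanSpace ℝ (Fin d)) : √ζ * ‖A w‖ ≤ ‖w‖ := by
  have h := Real.sqrt_le_sqrt (hA.norm_sq w)
  rwa [Real.sqrt_mul' _ (sq_nonneg _), Real.sqrt_sq (norm_nonneg _),
    Real.sqrt_sq (norm_nonneg _)] at h

/-- The third-order expansion of `f` along a preconditioned step. -/
lemma apply_sub_smul_le (hγ : 0 ≤ γ) (hζ : 0 < ζ) (hhess : LipschitzHessian γ f)
    (hA : IsPreconditioner (hessianOp f x) A ρ ζ) {s : ℝ} (hs : 0 ≤ s)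
    (w : EuclideanSpace ℝ (Fin d)) :
    f (x - s • A w) ≤ f x - s * ⟪A (∇ f x), w⟫_ℝ + s ^ 2 * ‖w‖ ^ 2
      + γ / 2 * (s ^ 3 / √ζ ^ 3) * ‖w‖ ^ 3 := by
  have h := hhess.apply_add_le hγ x (-(s • A w))
  rw [← sub_eq_add_neg, inner_neg_right, inner_smul_right, ← hA.symm, map_neg, inner_neg_neg,
    map_smul, inner_smul_left, inner_smul_right, norm_neg, norm_smul,
    Real.norm_of_nonneg hs] at h
  simp only [conj_trivial] at h
  have h2 := mul_le_mul_of_nonneg_left (hA.upper w) (sq_nonneg s)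
  have hz : 0 < √ζ := Real.sqrt_pos.2 hζ
  have h3 : ‖A w‖ ≤ ‖w‖ / √ζ := (le_div_iff₀' hz).2 (hA.sqrt_mul_norm_le w)
  have h4 : γ / 2 * (s * ‖A w‖) ^ 3 ≤ γ / 2 * (s ^ 3 / √ζ ^ 3) * ‖w‖ ^ 3 := by
    calc _ ≤ γ / 2 * (s * (‖w‖ / √ζ)) ^ 3 := by gcongr
      _ = _ := by ring
  linarith

/-- The closeness of `x` to the minimizer, as it enters the third-order remainder. -/
lemma mul_norm_mul_sq_le (hL : 0 < L) (hγ : 0 ≤ γ) (hρ1 : ρ ≤ 1) (hζ : 0 < ζ)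
    (hb : 1 ≤ b) (hsmooth : LSmooth L f) (hmin : ∀ y, f xstar ≤ f y)
    (hA : IsPreconditioner (hessianOp f x) A ρ ζ)
    (hx : γ * ‖x - xstar‖ ≤
      ρ * ((d : ℝ) ^ (3 / 2 : ℝ) * ζ ^ 2 / (33 * L * ((d : ℝ) + 2) * (b : ℝ) ^ 2))) :
    γ * ‖A (∇ f x)‖ * (b : ℝ) ^ 2 ≤ √ζ ^ 3 * √((d : ℝ) + 2) / 33 := by
  set z := √ζ with hz
  set q := √((d : ℝ) + 2) with hq
  have hz0 : 0 < z := Real.sqrt_pos.2 hζ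
  have hz2 : z ^ 2 = ζ := Real.sq_sqrt hζ.le
  have hq0 : 0 < q := Real.sqrt_pos.2 (by positivity)
  have hq2 : q ^ 2 = d + 2 := Real.sq_sqrt (by positivity)
  have hb0 : (0 : ℝ) < b := by exact_mod_cast hb
  have hd32 : (d : ℝ) ^ (3 / 2 : ℝ) ≤ q ^ 3 := by
    have h1 : q ^ 3 = ((d : ℝ) + 2) ^ (3 / 2 : ℝ) := by
      rw [hq, Real.sqrt_eq_rpow, ← Real.rpow_natCast, ← Real.rpow_mul (by positivity)]
      norm_num
    rw [h1]
    exact Real.rpow_le_rpow (by positivity) (by linarith) (by norm_num)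
  have hg : z * ‖A (∇ f x)‖ ≤ L * ‖x - xstar‖ := by
    refine (hA.sqrt_mul_norm_le _).trans ?_
    have := hsmooth.2 x xstar
    rwa [gradient_eq_zero_of_forall_le hmin, sub_zero] at this
  have hx' : γ * ‖x - xstar‖ ≤ q ^ 3 * ζ ^ 2 / (33 * L * q ^ 2 * (b : ℝ) ^ 2) := by
    refine hx.trans ?_
    rw [hq2]
    calc _ ≤ 1 * ((d : ℝ) ^ (3 / 2 : ℝ) * ζ ^ 2 / (33 * L * ((d : ℝ) + 2) * (b : ℝ) ^ 2)) := by
          gcongr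
      _ ≤ _ := by rw [one_mul]; gcongr
  refine le_of_mul_le_mul_left (a := z) ?_ hz0
  calc z * (γ * ‖A (∇ f x)‖ * (b : ℝ) ^ 2) = γ * (b : ℝ) ^ 2 * (z * ‖A (∇ f x)‖) := by ring
    _ ≤ γ * (b : ℝ) ^ 2 * (L * ‖x - xstar‖) := by gcongr
    _ = L * (b : ℝ) ^ 2 * (γ * ‖x - xstar‖) := by ring
    _ ≤ L * (b : ℝ) ^ 2 * (q ^ 3 * ζ ^ 2 / (33 * L * q ^ 2 * (b : ℝ) ^ 2)) := by gcongr
    _ = _ := by rw [← hz2]; field_simp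

section Arithmetic

/-- The mean-square error of the difference quotients is absorbed by the first term of the
smoothing error. -/
lemma quadratic_error_le {N D l : ℝ} (hD : 0 ≤ D) (hN : N = D + 2) (hζ : 0 < ζ)
    (hl : l = L * μ / (2 * ζ)) :
    1 / (16 * N) * l ^ 2 * (2 * (D * N) + D * (D + 4) / 8 + D * N / 8)
      ≤ μ ^ 2 * L ^ 2 / (64 * ζ ^ 2) * (D + 5) ^ 2 := by
  have hN0 : 0 < N := by linarith
  have h1 : 2 * (D * N) + D * (D + 4) / 8 + D * N / 8 ≤ N * (D + 5) ^ 2 := by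
    subst hN; nlinarith [mul_nonneg hD hD, mul_nonneg hD (mul_nonneg hD hD)]
  calc _ ≤ 1 / (16 * N) * l ^ 2 * (N * (D + 5) ^ 2) := by gcongr
    _ = _ := by rw [hl]; field_simp; ring

/-- The third moment of the errors of the difference quotients is absorbed by the last term of the
smoothing error. -/
lemma cubic_error_le {N D l z B : ℝ} (hD : 0 ≤ D) (hN : N = D + 2) (hz : 0 < z) (hL : 0 ≤ L)
    (hμ : 0 ≤ μ) (hγ : 0 ≤ γ) (hB : 0 ≤ B) (hl : l = L * μ / (2 * z ^ 2)) :
    γ / 2 * ((1 / (16 * N)) ^ 3 / z ^ 3)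
        * (B ^ 3 * (4 * l ^ 3 * (D * N * (D + 4) * (D + 6) * √(D + 8))))
      ≤ B * (γ * B ^ 2 * μ ^ 3 * L ^ 3 / (6144 * z ^ 9) * ((D + 110) * √(D + 110))) := by
  have hN0 : 0 < N := by linarith
  have h1 : D * (D + 4) * (D + 6) ≤ N ^ 2 * (D + 110) := by
    subst hN; nlinarith [mul_nonneg hD hD, mul_nonneg hD (mul_nonneg hD hD)]
  have h2 : √(D + 8) ≤ √(D + 110) := Real.sqrt_le_sqrt (by linarith)
  calc _ = γ * B ^ 3 * μ ^ 3 * L ^ 3 / (16384 * z ^ 9) / N ^ 2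
        * (D * (D + 4) * (D + 6) * √(D + 8)) := by rw [hl]; field_simp; ring
    _ ≤ γ * B ^ 3 * μ ^ 3 * L ^ 3 / (6144 * z ^ 9) / N ^ 2
        * (N ^ 2 * (D + 110) * √(D + 110)) := by gcongr; norm_num
    _ = _ := by field_simp

/-- The final balance: of the decrease `7 / 8` in units of `s b ‖h‖²`, the second moment uses up
`3 / 8` and the third moment `1 / 528`, and what is left exceeds `67 / 256`. -/
lemma step_balance {N q z B D l h G s I₁ I₂ I₃ : ℝ} (hD : 0 ≤ D) (hN : N = D + 2)
    (hq : 0 < q) (hq2 : q ^ 2 = N) (hz : 0 < z) (hB : 0 ≤ B) (hBN : B ≤ N) (hL : 0 ≤ L)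
    (hμ : 0 ≤ μ) (hγ : 0 ≤ γ) (hl : l = L * μ / (2 * z ^ 2))
    (hs : s = 1 / (16 * N)) (hG : ρ * G ≤ 67 / 64 * h ^ 2)
    (hγh : γ * h * B ^ 2 ≤ z ^ 3 * q / 33)
    (h1 : B * (7 / 8 * h ^ 2 - 2 * l ^ 2 * (D * N)) ≤ I₁)
    (h2 : I₂ ≤ B * (4 * N * h ^ 2 + 2 * l ^ 2 * (D * N * (D + 4)))
      + B ^ 2 * (2 * h ^ 2 + 2 * l ^ 2 * (D * N)))
    (h3 : I₃ ≤ B ^ 3 * (32 * q ^ 3 * h ^ 3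
      + 4 * l ^ 3 * (D * N * (D + 4) * (D + 6) * √(D + 8)))) :
    G - s * I₁ + s ^ 2 * I₂ + γ / 2 * (s ^ 3 / z ^ 3) * I₃
      ≤ (1 - B * ρ / (64 * N)) * G
        + B * (μ ^ 2 * L ^ 2 / (64 * (z ^ 2) ^ 2) * (D + 5) ^ 2
          + γ * B ^ 2 * μ ^ 3 * L ^ 3 / (6144 * z ^ 9) * ((D + 110) * √(D + 110))) := by
  have hN0 : 0 < N := by linarith
  have hs0 : 0 < s := by rw [hs]; positivity
  have hsN : s * N = 1 / 16 := by rw [hs]; field_simp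
  have hsB : s * B ≤ 1 / 16 := hsN ▸ mul_le_mul_of_nonneg_left hBN hs0.le
  have hfirst : s * (B * (7 / 8 * h ^ 2 - 2 * l ^ 2 * (D * N))) ≤ s * I₁ := by gcongr
  have hsecond : s ^ 2 * I₂
      ≤ s * B * (3 / 8 * h ^ 2 + l ^ 2 * (D * (D + 4) / 8 + D * N / 8)) := by
    calc s ^ 2 * I₂ ≤ s ^ 2 * (B * (4 * N * h ^ 2 + 2 * l ^ 2 * (D * N * (D + 4)))
          + B ^ 2 * (2 * h ^ 2 + 2 * l ^ 2 * (D * N))) := by gcongr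
      _ = s * B * ((s * N) * (4 * h ^ 2 + 2 * l ^ 2 * (D * (D + 4)))
          + (s * B) * (2 * h ^ 2 + 2 * l ^ 2 * (D * N))) := by ring
      _ ≤ s * B * (1 / 16 * (4 * h ^ 2 + 2 * l ^ 2 * (D * (D + 4)))
          + 1 / 16 * (2 * h ^ 2 + 2 * l ^ 2 * (D * N))) := by rw [hsN]; gcongr
      _ = _ := by ring
  have hthird : γ / 2 * (s ^ 3 / z ^ 3) * (B ^ 3 * (32 * q ^ 3 * h ^ 3))
      ≤ s * B * (1 / 528 * h ^ 2) := by
    calc γ / 2 * (s ^ 3 / z ^ 3) * (B ^ 3 * (32 * q ^ 3 * h ^ 3))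
        = 16 * s ^ 3 * B * q ^ 3 * h ^ 2 / z ^ 3 * (γ * h * B ^ 2) := by ring
      _ ≤ 16 * s ^ 3 * B * q ^ 3 * h ^ 2 / z ^ 3 * (z ^ 3 * q / 33) := by gcongr
      _ = s * B * (16 / 33 * (s * q ^ 2) ^ 2 * h ^ 2) := by field_simp
      _ = _ := by rw [hq2, hsN]; ring
  have hcubic : γ / 2 * (s ^ 3 / z ^ 3) * I₃ ≤ s * B * (1 / 528 * h ^ 2)
      + B * (γ * B ^ 2 * μ ^ 3 * L ^ 3 / (6144 * z ^ 9) * ((D + 110) * √(D + 110))) := by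
    calc _ ≤ γ / 2 * (s ^ 3 / z ^ 3) * (B ^ 3 * (32 * q ^ 3 * h ^ 3
          + 4 * l ^ 3 * (D * N * (D + 4) * (D + 6) * √(D + 8)))) := by gcongr
      _ = γ / 2 * (s ^ 3 / z ^ 3) * (B ^ 3 * (32 * q ^ 3 * h ^ 3))
          + γ / 2 * ((1 / (16 * N)) ^ 3 / z ^ 3)
            * (B ^ 3 * (4 * l ^ 3 * (D * N * (D + 4) * (D + 6) * √(D + 8)))) := by
        rw [hs]; ring
      _ ≤ _ := add_le_add hthird (cubic_error_le hD hN hz hL hμ hγ hB hl)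
  have hquad := mul_le_mul_of_nonneg_left
    (quadratic_error_le (μ := μ) (L := L) hD hN (by positivity : 0 < z ^ 2) hl) hB
  rw [← hs] at hquad
  have hgap : B * ρ / (64 * N) * G ≤ s * B * (67 / 256 * h ^ 2) := by
    calc B * ρ / (64 * N) * G = s * B / 4 * (ρ * G) := by rw [hs]; field_simp; ring
      _ ≤ s * B / 4 * (67 / 64 * h ^ 2) := by gcongr
      _ = _ := by ring
  have hpos : 0 ≤ s * B * h ^ 2 := by positivity
  nlinarith

end Arithmetic

/-- The descent estimate for one step with a preconditioner `A` and step `s = 1 / (16 (d + 2))`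
along the sum of the batch. -/
theorem integral_apply_step_le (hτ : 0 < τ) (hL : 0 < L) (hγ : 0 ≤ γ) (hρ : 0 < ρ) (hρ1 : ρ ≤ 1)
    (hζ : 0 < ζ) (hμ : 0 < μ) (hb : 1 ≤ b) (hbd : b ≤ d + 2)
    (hconv : StronglyConvex τ f) (hsmooth : LSmooth L f) (hhess : LipschitzHessian γ f)
    (hmin : ∀ y, f xstar ≤ f y) (hA : IsPreconditioner (hessianOp f x) A ρ ζ)
    (hx : γ * ‖x - xstar‖ ≤
      ρ * min (3 * τ * ζ ^ (1 / 2 : ℝ) / (64 * L ^ (1 / 2 : ℝ)))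
        ((d : ℝ) ^ (3 / 2 : ℝ) * ζ ^ 2 / (33 * L * ((d : ℝ) + 2) * (b : ℝ) ^ 2))) :
    Integrable (fun u : Batch d b =>
        f (x - (1 / (16 * ((d : ℝ) + 2))) • A (batchSum f μ A x u)) - f xstar) (batchLaw d b) ∧
      ∫ u : Batch d b,
          (f (x - (1 / (16 * ((d : ℝ) + 2))) • A (batchSum f μ A x u)) - f xstar) ∂(batchLaw d b) ≤
        (1 - (b : ℝ) * ρ / (64 * ((d : ℝ) + 2))) * (f x - f xstar)
          + smoothingError d b L γ ζ μ := by
  have hx1 : γ * ‖x - xstar‖ ≤ ρ * (3 * τ * √ζ / (64 * √L)) := by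
    rw [Real.sqrt_eq_rpow, Real.sqrt_eq_rpow]
    exact hx.trans (mul_le_mul_of_nonneg_left (min_le_left _ _) hρ.le)
  have hx2 := hx.trans (mul_le_mul_of_nonneg_left (min_le_right _ _) hρ.le)
  have hG := mul_gap_le_norm_sq hτ hL hγ hρ hρ1 hζ hconv hsmooth hhess hmin hA hx1
  have hγh := mul_norm_mul_sq_le hL hγ hρ1 hζ hb hsmooth hmin hA hx2
  have hc := nearLinear_diffQuotient (μ := μ) hL.le hμ hζ hsmooth hA
  set s := 1 / (16 * ((d : ℝ) + 2)) with hs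
  set h := A (∇ f x) with hh
  set c := diffQuotient f μ A x with hcdef
  have hs0 : 0 ≤ s := by positivity
  have hXc : Continuous fun u => c u • u := hc.continuous.smul continuous_id
  have hXg : PolyGrowth fun u => ‖c u • u‖ := by
    simpa only [norm_smul, Real.norm_eq_abs] using hc.polyGrowth.abs.mul PolyGrowth.norm
  have hcI : PolyGrowth fun u => c u * ⟪h, u⟫_ℝ := hc.polyGrowth.mul (PolyGrowth.inner_left h)
  have hwc : Continuous fun u : Batch d b => batchSum f μ A x u :=
    continuous_finsetSum _ fun i _ => hXc.comp (continuous_apply i)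
  have hinner : ∀ u : Batch d b, ⟪h, batchSum f μ A x u⟫_ℝ = ∑ i, c (u i) * ⟪h, u i⟫_ℝ := by
    intro u
    simp only [batchSum, inner_sum, inner_smul_right, hcdef]
  have i1 : Integrable (fun u : Batch d b => ⟪h, batchSum f μ A x u⟫_ℝ) (batchLaw d b) := by
    simp only [hinner]
    exact integrable_finsetSum _ fun i _ => hcI.integrable_eval i
  have i2 : Integrable (fun u : Batch d b => ‖batchSum f μ A x u‖ ^ 2) (batchLaw d b) :=
    integrable_norm_sum_pow hXc hXg 1
  have i3 : Integrable (fun u : Batch d b => ‖batchSum f μ A x u‖ ^ 3) (batchLaw d b) :=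
    integrable_norm_sum_pow hXc hXg 2
  have hI1 : (b : ℝ) * (7 / 8 * ‖h‖ ^ 2 - 2 * (L * μ / (2 * ζ)) ^ 2 * ((d : ℝ) * (d + 2)))
      ≤ ∫ u : Batch d b, ⟪h, batchSum f μ A x u⟫_ℝ ∂(batchLaw d b) := by
    simp only [hinner]
    rw [integral_finsetSum _ fun i _ => hcI.integrable_eval i]
    have : ∀ i : Fin b, ∫ u : Batch d b, c (u i) * ⟪h, u i⟫_ℝ ∂(batchLaw d b)
        = ∫ u, c u * ⟪h, u⟫_ℝ ∂(stdGaussian (EuclideanSpace ℝ (Fin d))) :=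
      integral_eval_batchLaw hcI.1
    simp only [this, Finset.sum_const, Finset.card_univ, Fintype.card_fin, nsmul_eq_mul]
    exact mul_le_mul_of_nonneg_left hc.le_integral_mul_inner b.cast_nonneg
  have hI2 := integral_norm_sum_sq_le (b := b) hXc hXg
  have hI2' := hI2.trans (add_le_add
    (mul_le_mul_of_nonneg_left hc.integral_norm_smul_sq_le b.cast_nonneg)
    (mul_le_mul_of_nonneg_left (hc.norm_integral_smul_sq_le.trans hc.integral_sq_le)
      (sq_nonneg (b : ℝ))))
  have hq0 : 0 < √((d : ℝ) + 2) := Real.sqrt_pos.2 (by positivity)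
  have hq2 : √((d : ℝ) + 2) ^ 2 = (d : ℝ) + 2 := Real.sq_sqrt (by positivity)
  have hI3 := (integral_norm_sum_pow_le (b := b) hXc hXg 2).trans
    (mul_le_mul_of_nonneg_left (hc.integral_norm_smul_pow_three_le hq0 hq2)
      (pow_nonneg b.cast_nonneg 3))
  have j1 := i1.const_mul s
  have j2 := i2.const_mul (s ^ 2)
  have j3 := i3.const_mul (γ / 2 * (s ^ 3 / √ζ ^ 3))
  have k1 : Integrable (fun u : Batch d b => (f x - f xstar) - s * ⟪h, batchSum f μ A x u⟫_ℝ)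
      (batchLaw d b) := (integrable_const _).sub j1
  have k2 : Integrable (fun u : Batch d b => (f x - f xstar) - s * ⟪h, batchSum f μ A x u⟫_ℝ
      + s ^ 2 * ‖batchSum f μ A x u‖ ^ 2) (batchLaw d b) := k1.add j2
  have hdom : Integrable (fun u : Batch d b => (f x - f xstar) - s * ⟪h, batchSum f μ A x u⟫_ℝ
      + s ^ 2 * ‖batchSum f μ A x u‖ ^ 2
      + γ / 2 * (s ^ 3 / √ζ ^ 3) * ‖batchSum f μ A x u‖ ^ 3) (batchLaw d b) := k2.add j3
  have hle : ∀ u : Batch d b, f (x - s • A (batchSum f μ A x u)) - f xstar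
      ≤ (f x - f xstar) - s * ⟪h, batchSum f μ A x u⟫_ℝ
        + s ^ 2 * ‖batchSum f μ A x u‖ ^ 2
        + γ / 2 * (s ^ 3 / √ζ ^ 3) * ‖batchSum f μ A x u‖ ^ 3 := fun u => by
    have := apply_sub_smul_le hγ hζ hhess hA hs0 (batchSum f μ A x u)
    linarith
  have hint : Integrable (fun u : Batch d b => f (x - s • A (batchSum f μ A x u)) - f xstar)
      (batchLaw d b) := by
    have hfc := hsmooth.1.continuous
    refine hdom.mono' (Continuous.aestronglyMeasurable (by fun_prop))
      (Filter.Eventually.of_forall fun u => ?_)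
    rw [Real.norm_of_nonneg (sub_nonneg.2 (hmin _))]
    exact hle u
  refine ⟨hint, (integral_mono hint hdom hle).trans ?_⟩
  rw [integral_add k2 j3, integral_add k1 j2, integral_sub (integrable_const _) j1,
    integral_const_mul, integral_const_mul, integral_const_mul, integral_const]
  simp only [probReal_univ, smul_eq_mul, one_mul]
  have hz2 : √ζ ^ 2 = ζ := Real.sq_sqrt hζ.le
  have hfinal := step_balance (D := d) (B := b) (N := d + 2) (l := L * μ / (2 * ζ)) (μ := μ)
    (z := √ζ) d.cast_nonneg rfl
    hq0 hq2 (Real.sqrt_pos.2 hζ) b.cast_nonneg (by exact_mod_cast hbd) hL.le hμ.le hγ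
    (by rw [hz2]) hs hG hγh hI1 hI2' hI3
  refine hfinal.trans ?_
  -- The second term of the smoothing error is not needed.
  have e1 : ζ ^ (9 / 2 : ℝ) = √ζ ^ 9 := by
    rw [Real.sqrt_eq_rpow, ← Real.rpow_natCast, ← Real.rpow_mul hζ.le]; norm_num
  have e2 : ((d : ℝ) + 110) ^ (3 / 2 : ℝ) = ((d : ℝ) + 110) * √((d : ℝ) + 110) := by
    rw [Real.sqrt_eq_rpow, ← Real.rpow_one_add' (by positivity) (by norm_num)]; norm_num
  rw [smoothingError, e1, e2, hz2]
  gcongr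
  have : 0 ≤ μ ^ 2 * L ^ 2 / (128 * ζ) * ((d : ℝ) + 38) := by positivity
  linarith

end Step

/-! ### The iterates of the algorithm -/

theorem theorem1 {d b : ℕ} (f : EuclideanSpace ℝ (Fin d) → ℝ) (τ L γ ρ ζ μ : ℝ)
    (hτ : 0 < τ) (hL : 0 < L) (hγ : 0 ≤ γ) (hρ : 0 < ρ) (hρ1 : ρ ≤ 1) (hζ : 0 < ζ) (hμ : 0 < μ)
    (hb : 1 ≤ b) (hbd : b ≤ d + 2)
    (hconv : StronglyConvex τ f) (hsmooth : LSmooth L f) (hhess : LipschitzHessian γ f)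
    (xstar : EuclideanSpace ℝ (Fin d)) (hmin : ∀ y, f xstar ≤ f y)
    (p : ℕ) (A : (t : ℕ) → (Fin t → Batch d b) → Matrix (Fin d) (Fin d) ℝ)
    (x₀ : EuclideanSpace ℝ (Fin d)) (η : ℝ) (hη : η = (b : ℝ) / (16 * ((d : ℝ) + 2)))
    (t : ℕ) (U : Fin t → Batch d b)
    (hH : IsApproxHessian f ρ ζ (iterate f μ η p A x₀ t U) (approxHess p A t U))
    (hx : γ * ‖iterate f μ η p A x₀ t U - xstar‖ ≤
      ρ * min (3 * τ * ζ ^ (1 / 2 : ℝ) / (64 * L ^ (1 / 2 : ℝ)))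
        ((d : ℝ) ^ (3 / 2 : ℝ) * ζ ^ 2 / (33 * L * ((d : ℝ) + 2) * (b : ℝ) ^ 2))) :
    Integrable
        (fun u : Batch d b =>
          f (iterate f μ η p A x₀ (t + 1) (Fin.snoc (α := fun _ => Batch d b) U u)) - f xstar)
        (batchLaw d b) ∧
      ∫ u : Batch d b,
          (f (iterate f μ η p A x₀ (t + 1) (Fin.snoc (α := fun _ => Batch d b) U u)) - f xstar)
          ∂(batchLaw d b) ≤
        (1 - (b : ℝ) * ρ / (64 * ((d : ℝ) + 2))) * (f (iterate f μ η p A x₀ t U) - f xstar)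
          + smoothingError d b L γ ζ μ := by
  have hb0 : (b : ℝ) ≠ 0 := by exact_mod_cast (by omega : b ≠ 0)
  have hstep : ∀ u : Batch d b,
      iterate f μ η p A x₀ (t + 1) (Fin.snoc (α := fun _ => Batch d b) U u)
        = iterate f μ η p A x₀ t U - (1 / (16 * ((d : ℝ) + 2))) •
          invSqrt (approxHess p A t U)
            (batchSum f μ (invSqrt (approxHess p A t U)) (iterate f μ η p A x₀ t U) u) := by
    intro u
    rw [iterate, Fin.init_snoc, Fin.snoc_last, direction_eq, smul_smul, hη]
    congr 2
    field_simp
  simp only [hstep]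
  exact integral_apply_step_le hτ hL hγ hρ hρ1 hζ hμ hb hbd hconv hsmooth hhess hmin
    (isPreconditioner_invSqrt hρ.le hζ hH) hx
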